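/- **Setting.** *Determinations.* $\mathfrak B=\{\bot,\mathbf Y,\mathbf N\}$ is ordered flatly ($\bot$ below everything, $\mathbf Y,\mathbf N$ incomparable), with involution $\mathbf Y^\star=\mathbf N$, $\mathbf N^\star=\mathbf Y$. The commutative product $\bullet$ has $\mathbf Y$ neutral, $\mathbf N$ absorbing and $\bot\bullet\bot=\bot$. $\bigwedge$ denotes the infimum of a non-empty family: its common value if there is one, and $\bot$ otherwise. *One-dimensional indeterministic spaces.* For $N\ge 2$, $\mathfrak Z'_N$ consists of $\bot$ and $2N$ pairwise incomparable elements $\sigma_1,\dots,\sigma_N,\sigma_1^\star,\dots,\sigma_N^\star$ above $\bot$; the star exchanges $\sigma_i$ and $\sigma_i^\star$. In any of the spaces considered here the star is a map on the elements $\neq\bot$, and the pure states are the maximal elements. *Real effects.* The real effects of a space $S$ are $\mathfrak l_{(\sigma,\sigma')}$ with $\sigma,\sigma'\in S\setminus\{\bot\}$ and $\sigma^\star\sqsubseteq\sigma'$, together with $\mathfrak l_{(\sigma,\cdot)}$, $\mathfrak l_{(\cdot,\sigma)}$ ($\sigma\in S$) and $\mathfrak l_{(\cdot,\cdot)}$.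 The real measurement $\mathfrak m_{\mathfrak l}:S\to\mathfrak B$ attached to $\mathfrak l_{(\sigma,\sigma')}$ takes the value $\mathbf Y$ at $x$ if $\sigma\sqsubseteq x$, $\mathbf N$ if $\sigma'\sqsubseteq x$, and $\bot$ otherwise (a dot is below nothing). *Minimal tensor product.* $S\widetilde\otimes T$ is the set of non-empty subsets $u\subseteq S\times T$, where $u,v$ are identified when $\nu_{\mathfrak l,\mathfrak m}(u)=\nu_{\mathfrak l,\mathfrak m}(v)$ for all real effects $\mathfrak l$ of $S$ and $\mathfrak m$ of $T$, with $\nu_{\mathfrak l,\mathfrak m}(u)=\bigwedge_{(a,b)\in u}\mathfrak m_{\mathfrak l}(a)\bullet\mathfrak m_{\mathfrak m}(b)$. It is ordered by comparing all the $\nu_{\mathfrak l,\mathfrak m}$; the infimum is induced by the union. The class of $u$ is written $\sqcap_{(a,b)\in u}\,a\widetilde\otimes b$, and the bottom element is $\bot\widetilde\otimes\bot$. For pure $a,b$ one sets $(a\widetilde\otimes b)^\star=a^\star\widetilde\otimes\bot\sqcap\bot\widetilde\otimes b^\star$, and $x^\star$ is the supremum of the $(a\widetilde\otimes b)^\star$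 over all pure $a,b$ with $x\sqsubseteq a\widetilde\otimes b$. *Ontic completion.* Let $(S',\star)$ be such a space. For $U,V\subseteq S'$ write $U\sqsubseteq V$ if each element of $U$ lies below an element of $V$. Let $\mathfrak c(U)$ be the set of maximal elements of $\{\bigsqcup V: V\sqsubseteq U,\ V \text{ bounded above}\}$, and $cl_c(U)$ the set of maximal elements of $\bigcup_{n\ge1}\mathfrak c^{n}(U)$. Let $\mathcal K$ be the family of all $U\subseteq S'\setminus\{\bot\}$ with $\sigma^\star\not\sqsubseteq\sigma'$ for all $\sigma,\sigma'\in U$; let $\mathcal Q_c$ be the family of all $U\subseteq S'\setminus\{\bot\}$ with $cl_c(U)\in\mathcal K$, together with $\{\bot\}$. The ontic completion is $\mathfrak J^c_{S'}=\{cl_c(U):U\in\mathcal Q_c\}$, ordered by $\sqsubseteq$. A real state $\sigma\in S'$ is identified with $\{\sigma\}$; the other elements of $\mathfrak J^c_{S'}$ are the hidden states. *Measurements on hidden states.* For real measurements $\varphi$ of $S$ and $\rho$ of $T$ and $J\in\mathfrak J^c_{S\widetilde\otimes T}$, $$(\varphi\widetilde\otimes\rho)(J)=cl_c\big(\{\sqcap_i\,\varphi(a_i)\widetilde\otimes\rho(b_i)\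 :\ \sqcap_i\,a_i\widetilde\otimes b_i\in J\}\big).$$ *Marginals and Bell non-locality.* Write $\mathfrak B^{\widetilde\otimes4}=(\mathfrak B\widetilde\otimes\mathfrak B)\widetilde\otimes(\mathfrak B\widetilde\otimes\mathfrak B)$ and, for $i\in\{1,2\}$, $j\in\{3,4\}$, let $\zeta_{(i)(j)}:\mathfrak B^{\widetilde\otimes 4}\to\mathfrak B\widetilde\otimes\mathfrak B$ be the partial trace $\sqcap\, a_1\widetilde\otimes a_2\widetilde\otimes a_3\widetilde\otimes a_4\mapsto\sqcap\, a_i\widetilde\otimes a_j$. A state $\Sigma\in\mathfrak J^c_{S\widetilde\otimes T}$ is *Bell non-local* if there are real measurements $\varphi_1,\varphi_2$ of $S$ and $\rho_1,\rho_2$ of $T$ for which no $\Lambda\in\mathfrak B^{\widetilde\otimes4}$ satisfies simultaneously $$\zeta_{(1)(3)}(\Lambda)=(\varphi_1\widetilde\otimes\rho_1)(\Sigma),\quad \zeta_{(1)(4)}(\Lambda)=(\varphi_1\widetilde\otimes\rho_2)(\Sigma),\quad \zeta_{(2)(3)}(\Lambda)=(\varphi_2\widetilde\otimes\rho_1)(\Sigma),\quad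 \zeta_{(2)(4)}(\Lambda)=(\varphi_2\widetilde\otimes\rho_2)(\Sigma).\tag{$*$}$$ **Theorem.** Let $N_A,N_B\ge2$. The ontic completion $\mathfrak J^c_{\mathfrak Z'_{N_A}\widetilde\otimes\mathfrak Z'_{N_B}}$ contains a Bell non-local hidden state. More precisely, let $\sigma_1,\sigma_2$ be pure states of $\mathfrak Z'_{N_A}$ with $\sigma_1\ne\sigma_2,\sigma_2^\star$, and $\tau_1,\tau_2$ pure states of $\mathfrak Z'_{N_B}$ with $\tau_1\neq\tau_2,\tau_2^\star$. Then in the ontic completion the supremum $$\Sigma=(\sigma_1\widetilde\otimes\tau_1\sqcap\sigma_2\widetilde\otimes\tau_2)\sqcup(\sigma_1^\star\widetilde\otimes\bot\sqcap\bot\widetilde\otimes\tau_1^\star)$$ of these two real states exists and is a hidden state. For $\varphi_i=\mathfrak m_{\mathfrak l_{(\sigma_i,\sigma_i^\star)}}$ and $\rho_i=\mathfrak m_{\mathfrak l_{(\tau_i,\tau_i^\star)}}$ one has $$(\varphi_1\widetilde\otimes\rho_1)(\Sigma)=\mathbf N\widetilde\otimes\bot\sqcap\mathbf Y\widetilde\otimes\mathbf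 N,\quad (\varphi_1\widetilde\otimes\rho_2)(\Sigma)=\mathbf Y\widetilde\otimes\bot\sqcap\mathbf N\widetilde\otimes\mathbf Y,$$ $$(\varphi_2\widetilde\otimes\rho_1)(\Sigma)=\mathbf Y\widetilde\otimes\mathbf N\sqcap\bot\widetilde\otimes\mathbf Y,\quad (\varphi_2\widetilde\otimes\rho_2)(\Sigma)=\bot\widetilde\otimes\bot,$$ and no $\Lambda\in\mathfrak B^{\widetilde\otimes4}$ satisfies the four equations $(*)$. In particular $\Sigma$ is Bell non-local. -/

import Mathlib

noncomputable section

namespace Ontic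

/-! ### The boolean space `𝔅 = {⊥, Y, N}` -/

/-- The three determinations: indeterminate, yes, no. -/
inductive B : Type
  | bot
  | yes
  | no

namespace B

/-- The flat order: `⊥` lies below everything; `Y` and `N` are incomparable. -/
instance : PartialOrder B where
  le x y := x = bot ∨ x = y
  le_refl x := Or.inr rfl
  le_trans x y z := by
    rintro (h | rfl) h2
    · exact Or.inl h
    · exact h2
  le_antisymm x y := by
    rintro (rfl | rfl) h2
    · rcases h2 with h | h <;> exact h.symm
    · rfl

instance : OrderBot B where
  bot := bot
  bot_le _ := Or.inl rfl

/-- The involution exchanging `Y` and `N`. -/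
instance : Star B where
  star x := match x with
    | bot => bot
    | yes => no
    | no => yes

/-- The product of two determinations: `Y` is neutral, `N` is absorbing, `⊥ • ⊥ = ⊥`. -/
def prod (x y : B) : B :=
  match x, y with
  | no, _ => no
  | _, no => no
  | yes, y => y
  | bot, _ => bot

open Classical in
/-- The infimum of a non-empty family of determinations: the common value if there is one,
and `⊥` otherwise. -/
def inf (s : Set B) : B :=
  if s = {yes} then yes else if s = {no} then no else bot

theorem isGLB_inf {s : Set B} (hs : s.Nonempty) : IsGLB s (inf s) := by
  unfold inf
  split_ifs with h1 h2
  · rw [h1]; exact isGLB_singleton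
  · rw [h2]; exact isGLB_singleton
  · refine ⟨fun x _ => Or.inl rfl, fun c hc => ?_⟩
    rcases c with _ | _ | _
    · exact Or.inr rfl
    · exact absurd (Set.eq_singleton_iff_nonempty_unique_mem.2 ⟨hs, fun x hx =>
        ((hc hx).resolve_left (by simp)).symm⟩) h1
    · exact absurd (Set.eq_singleton_iff_nonempty_unique_mem.2 ⟨hs, fun x hx =>
        ((hc hx).resolve_left (by simp)).symm⟩) h2

theorem prod_mono {x x' y y' : B} (hx : x ≤ x') (hy : y ≤ y') : prod x y ≤ prod x' y' := by
  rcases hx with rfl | rfl <;> rcases hy with rfl | rfl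
  · rcases x' <;> rcases y' <;> exact Or.inl rfl
  · rcases x' <;> rcases y <;> first | exact Or.inl rfl | exact Or.inr rfl
  · rcases x <;> rcases y' <;> first | exact Or.inl rfl | exact Or.inr rfl
  · exact le_rfl

end B

/-! ### The one-dimensional indeterministic spaces `Z'_N` -/

/-- The space `Z'_N`: a bottom element and `2 N` pairwise incomparable pure states
`σ_i = pure i false`, `σ_i⋆ = pure i true`. -/
inductive Qubit (N : ℕ) : Type
  | bot
  | pure (i : Fin N) (b : Bool)

namespace Qubit

instance (N : ℕ) : PartialOrder (Qubit N) where
  le x y := x = bot ∨ x = y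
  le_refl x := Or.inr rfl
  le_trans x y z := by
    rintro (h | rfl) h2
    · exact Or.inl h
    · exact h2
  le_antisymm x y := by
    rintro (rfl | rfl) h2
    · rcases h2 with h | h <;> exact h.symm
    · rfl

instance (N : ℕ) : OrderBot (Qubit N) where
  bot := bot
  bot_le _ := Or.inl rfl

instance (N : ℕ) : Star (Qubit N) where
  star x := match x with
    | bot => bot
    | pure i b => pure i (!b)

end Qubit

/-! ### Real effects

In every space the star is a map on the elements different from `⊥`; its value at `⊥` is a
convention which is never used. -/

/-- The real effects `𝔩_(σ,σ')` (with `σ, σ' ≠ ⊥` and `σ⋆ ≤ σ'`), `𝔩_(σ,·)`, `𝔩_(·,σ)` and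
`𝔩_(·,·)` of a space of real states; a dot is encoded by `none`. -/
structure RealEffect (S : Type) [PartialOrder S] [OrderBot S] [Star S] where
  pos : Option S
  neg : Option S
  compat : ∀ s ∈ pos, ∀ t ∈ neg, s ≠ ⊥ ∧ t ≠ ⊥ ∧ star s ≤ t

open Classical in
/-- The real measurement associated with a real effect (on real states): `𝔩_(σ,σ')` takes the
value `Y` on the states above `σ`, `N` on the states above `σ'`, and `⊥` elsewhere. -/
def RealEffect.eval {S : Type} [PartialOrder S] [OrderBot S] [Star S]
    (l : RealEffect S) (x : S) : B :=
  if ∃ s ∈ l.pos, s ≤ x then B.yes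
  else if ∃ t ∈ l.neg, t ≤ x then B.no
  else B.bot

theorem RealEffect.eval_congr {S T : Type} [PartialOrder S] [OrderBot S] [Star S]
    [PartialOrder T] [OrderBot T] [Star T] {l : RealEffect S} {m : RealEffect T} {x : S} {y : T}
    (h1 : (∃ s ∈ l.pos, s ≤ x) ↔ ∃ s ∈ m.pos, s ≤ y)
    (h2 : (∃ s ∈ l.neg, s ≤ x) ↔ ∃ s ∈ m.neg, s ≤ y) : l.eval x = m.eval y := by
  unfold RealEffect.eval
  by_cases p : ∃ s ∈ m.pos, s ≤ y
  · rw [if_pos (h1.2 p), if_pos p]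
  · rw [if_neg (mt h1.1 p), if_neg p]
    by_cases q : ∃ s ∈ m.neg, s ≤ y
    · rw [if_pos (h2.2 q), if_pos q]
    · rw [if_neg (mt h2.1 q), if_neg q]

/-- The real effect `𝔩_(σ,σ⋆)`. -/
def RealEffect.ofState {S : Type} [PartialOrder S] [OrderBot S] [Star S]
    (s : S) (hs : s ≠ ⊥) (hs' : star s ≠ ⊥) : RealEffect S where
  pos := some s
  neg := some (star s)
  compat := by
    rintro _ ⟨⟩ _ ⟨⟩
    exact ⟨hs, hs', le_rfl⟩

theorem Qubit.star_ne_bot {N : ℕ} {x : Qubit N} (hx : x ≠ ⊥) : star x ≠ ⊥ := by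
  rcases x with _ | ⟨i, b⟩
  · exact absurd rfl hx
  · simp [star, Bot.bot]

/-- The real effect `𝔩_(σ,σ⋆)` of `Z'_N` for a pure state `σ`; the pure (that is, maximal) states
of `Z'_N` are the elements different from `⊥`. -/
def Qubit.effect {N : ℕ} (x : Qubit N) (hx : x ≠ ⊥) : RealEffect (Qubit N) :=
  RealEffect.ofState x hx (Qubit.star_ne_bot hx)

/-! ### The minimal tensor product -/

section Tensor

variable (S T : Type) [PartialOrder S] [OrderBot S] [Star S]
  [PartialOrder T] [OrderBot T] [Star T]

variable {S T} in
/-- The map `ν_{l,m}` on subsets of `S × T`. -/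
def nu (l : RealEffect S) (m : RealEffect T) (u : Set (S × T)) : B :=
  B.inf ((fun p : S × T => B.prod (l.eval p.1) (m.eval p.2)) '' u)

/-- Two non-empty sets of pairs are identified when no pair of real effects separates them. -/
def tensorSetoid : Setoid {u : Set (S × T) // u.Nonempty} where
  r u v := ∀ (l : RealEffect S) (m : RealEffect T), nu l m u.1 = nu l m v.1
  iseqv := ⟨fun _ _ _ => rfl, fun h l m => (h l m).symm, fun h h' l m => (h l m).trans (h' l m)⟩

/-- The minimal tensor product. -/
def Tensor : Type := Quotient (tensorSetoid S T)

variable {S T}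

/-- The state `⊓_{(a,b) ∈ u} a ⊗ b`. -/
def Tensor.mk (u : Set (S × T)) (hu : u.Nonempty) : Tensor S T :=
  Quotient.mk (tensorSetoid S T) ⟨u, hu⟩

/-- The pure tensor `a ⊗ b`. -/
def Tensor.tmul (a : S) (b : T) : Tensor S T :=
  Tensor.mk {(a, b)} (Set.singleton_nonempty _)

/-- The state `a ⊗ b ⊓ a' ⊗ b'`. -/
def Tensor.pair (a : S) (b : T) (a' : S) (b' : T) : Tensor S T :=
  Tensor.mk {(a, b), (a', b')} (Set.insert_nonempty _ _)

/-- The value `ν_{l,m}` of a state of the tensor product. -/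
def Tensor.value (l : RealEffect S) (m : RealEffect T) (x : Tensor S T) : B :=
  Quotient.lift (fun u : {u : Set (S × T) // u.Nonempty} => nu l m u.1)
    (fun u v (h : (tensorSetoid S T).r u v) => h l m) x

/-- The order of the tensor product; the infimum of two states is given by the union of
representatives. -/
instance : PartialOrder (Tensor S T) where
  le x y := ∀ (l : RealEffect S) (m : RealEffect T), x.value l m ≤ y.value l m
  le_refl x l m := le_rfl
  le_trans x y z h h' l m := (h l m).trans (h' l m)
  le_antisymm x y h h' := by
    induction x using Quotient.inductionOn with | _ u => ?_
    induction y using Quotient.inductionOn with | _ v => ?_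
    exact Quotient.sound fun l m => le_antisymm (h l m) (h' l m)

theorem RealEffect.eval_bot_le (l : RealEffect S) (y : S) : l.eval ⊥ ≤ l.eval y := by
  unfold RealEffect.eval
  split_ifs with h1 h2 h3 h4 h5 h6 h7
  all_goals first | exact le_rfl | exact Or.inl rfl | skip
  · obtain ⟨s, hs, hs'⟩ := h1
    exact absurd ⟨s, hs, hs'.trans bot_le⟩ h2
  · obtain ⟨s, hs, hs'⟩ := h1
    exact absurd ⟨s, hs, hs'.trans bot_le⟩ h2
  · obtain ⟨t, ht, ht'⟩ := h4
    obtain ⟨s, hs, hs'⟩ := h5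
    exact absurd (le_bot_iff.1 ht') (l.compat s hs t ht).2.1
  · obtain ⟨t, ht, ht'⟩ := h4
    exact absurd ⟨t, ht, ht'.trans bot_le⟩ h6

theorem nu_singleton (l : RealEffect S) (m : RealEffect T) (a : S) (b : T) :
    nu l m {(a, b)} = B.prod (l.eval a) (m.eval b) := by
  have h := B.isGLB_inf (s := {B.prod (l.eval a) (m.eval b)}) (Set.singleton_nonempty _)
  unfold nu
  rw [Set.image_singleton]
  exact h.unique isGLB_singleton

theorem isGLB_nu (l : RealEffect S) (m : RealEffect T) {u : Set (S × T)} (hu : u.Nonempty) :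
    IsGLB ((fun p : S × T => B.prod (l.eval p.1) (m.eval p.2)) '' u) (nu l m u) :=
  B.isGLB_inf (hu.image _)

/-- The bottom element is `⊥ ⊗ ⊥`. -/
instance : OrderBot (Tensor S T) where
  bot := Tensor.tmul ⊥ ⊥
  bot_le x := by
    induction x using Quotient.inductionOn with | _ u => ?_
    intro l m
    change nu l m {(⊥, ⊥)} ≤ nu l m u.1
    rw [nu_singleton]
    refine (isGLB_nu l m u.2).2 ?_
    rintro _ ⟨p, -, rfl⟩
    exact B.prod_mono (l.eval_bot_le _) (m.eval_bot_le _)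

open Classical in
/-- The star of the tensor product. On pure tensors of pure (that is, maximal) states it is
`(a ⊗ b)⋆ = a⋆ ⊗ ⊥ ⊓ ⊥ ⊗ b⋆`; the star of a general state is the supremum of the stars of the
pure states above it. -/
instance : Star (Tensor S T) where
  star x :=
    let W : Set (Tensor S T) := {y | ∃ (a : S) (b : T), IsMax a ∧ IsMax b ∧
      x ≤ Tensor.tmul a b ∧ y = Tensor.pair (star a) ⊥ ⊥ (star b)}
    if h : ∃ z, IsLUB W z then h.choose else ⊥

end Tensor

/-! ### Tensor product of real maps -/

/-- A map between spaces of real states which pulls back real effects to real effects. -/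
def IsRealMap {S T : Type} [PartialOrder S] [OrderBot S] [Star S]
    [PartialOrder T] [OrderBot T] [Star T] (f : S → T) : Prop :=
  ∀ l : RealEffect T, ∃ l' : RealEffect S, ∀ x, l.eval (f x) = l'.eval x

/-- `(f ⊗ g) (⊓_i a_i ⊗ b_i) = ⊓_i f (a_i) ⊗ g (b_i)`. -/
def Tensor.map {S T S' T' : Type} [PartialOrder S] [OrderBot S] [Star S]
    [PartialOrder T] [OrderBot T] [Star T] [PartialOrder S'] [OrderBot S'] [Star S']
    [PartialOrder T'] [OrderBot T'] [Star T'] (f : S → S') (hf : IsRealMap f)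
    (g : T → T') (hg : IsRealMap g) (x : Tensor S T) : Tensor S' T' :=
  Quotient.lift (fun u : {u : Set (S × T) // u.Nonempty} =>
      Tensor.mk (Prod.map f g '' u.1) (u.2.image _))
    (fun u v (h : (tensorSetoid S T).r u v) => Quotient.sound (by
      intro l m
      obtain ⟨l', hl⟩ := hf l
      obtain ⟨m', hm⟩ := hg m
      have key : ∀ w : Set (S × T), nu l m (Prod.map f g '' w) = nu l' m' w := by
        intro w
        simp only [nu, Set.image_image, Prod.map, hl, hm]
      change nu l m (Prod.map f g '' u.1) = nu l m (Prod.map f g '' v.1)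
      rw [key, key, h l' m'])) x

/-! ### Partial traces of `𝔅 ⊗ 𝔅` -/

/-- The effect `𝔩_(Y,N)` of `𝔅`. -/
def B.idEffect : RealEffect B where
  pos := some B.yes
  neg := some B.no
  compat := by
    rintro _ ⟨⟩ _ ⟨⟩
    exact ⟨by simp [Bot.bot], by simp [Bot.bot], Or.inr rfl⟩

/-- The effect `𝔩_(⊥,·)`, constantly equal to `Y`. -/
def RealEffect.top (S : Type) [PartialOrder S] [OrderBot S] [Star S] : RealEffect S where
  pos := some ⊥
  neg := none
  compat := by simp

theorem B.eval_idEffect (x : B) : B.idEffect.eval x = x := by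
  rcases x <;> simp [RealEffect.eval, B.idEffect, LE.le]

theorem RealEffect.eval_top {S : Type} [PartialOrder S] [OrderBot S] [Star S] (x : S) :
    (RealEffect.top S).eval x = B.yes := by
  simp [RealEffect.eval, RealEffect.top]

theorem B.prod_yes (x : B) : B.prod x B.yes = x := by cases x <;> rfl

theorem B.yes_prod (x : B) : B.prod B.yes x = x := by cases x <;> rfl

theorem B.eval_mono (l : RealEffect B) {x y : B} (h : x ≤ y) : l.eval x ≤ l.eval y := by
  rcases h with rfl | rfl
  · exact l.eval_bot_le y
  · exact le_rfl

theorem B.nu_fst (u : Set (B × B)) :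
    nu B.idEffect (RealEffect.top B) u = B.inf (Prod.fst '' u) := by
  simp only [nu, B.eval_idEffect, RealEffect.eval_top, B.prod_yes]

theorem B.nu_snd (u : Set (B × B)) :
    nu (RealEffect.top B) B.idEffect u = B.inf (Prod.snd '' u) := by
  simp only [nu, B.eval_idEffect, RealEffect.eval_top, B.yes_prod]

/-- The partial trace `⊓_i a_i ⊗ b_i ↦ ⊓_i a_i`. -/
def zeta1 (x : Tensor B B) : B :=
  Quotient.lift (fun u : {u : Set (B × B) // u.Nonempty} => B.inf (Prod.fst '' u.1))
    (fun u v (h : (tensorSetoid B B).r u v) => by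
      rw [← B.nu_fst, ← B.nu_fst, h]) x

/-- The partial trace `⊓_i a_i ⊗ b_i ↦ ⊓_i b_i`. -/
def zeta2 (x : Tensor B B) : B :=
  Quotient.lift (fun u : {u : Set (B × B) // u.Nonempty} => B.inf (Prod.snd '' u.1))
    (fun u v (h : (tensorSetoid B B).r u v) => by
      rw [← B.nu_snd, ← B.nu_snd, h]) x

theorem tmul_bot_le_iff (s : B) (x : Tensor B B) : Tensor.tmul s ⊥ ≤ x ↔ s ≤ zeta1 x := by
  induction x using Quotient.inductionOn with | _ u => ?_
  change (∀ l m, nu l m {(s, ⊥)} ≤ nu l m u.1) ↔ s ≤ B.inf (Prod.fst '' u.1)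
  constructor
  · intro h
    have := h B.idEffect (RealEffect.top B)
    rwa [nu_singleton, B.nu_fst, B.eval_idEffect, RealEffect.eval_top, B.prod_yes] at this
  · intro h l m
    rw [nu_singleton]
    refine (isGLB_nu l m u.2).2 ?_
    rintro _ ⟨p, hp, rfl⟩
    exact B.prod_mono (B.eval_mono l
      (h.trans ((B.isGLB_inf (u.2.image _)).1 ⟨p, hp, rfl⟩))) (m.eval_bot_le _)

theorem bot_tmul_le_iff (s : B) (x : Tensor B B) : Tensor.tmul ⊥ s ≤ x ↔ s ≤ zeta2 x := by
  induction x using Quotient.inductionOn with | _ u => ?_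
  change (∀ l m, nu l m {(⊥, s)} ≤ nu l m u.1) ↔ s ≤ B.inf (Prod.snd '' u.1)
  constructor
  · intro h
    have := h (RealEffect.top B) B.idEffect
    rwa [nu_singleton, B.nu_snd, B.eval_idEffect, RealEffect.eval_top, B.yes_prod] at this
  · intro h l m
    rw [nu_singleton]
    refine (isGLB_nu l m u.2).2 ?_
    rintro _ ⟨p, hp, rfl⟩
    exact B.prod_mono (l.eval_bot_le _) (B.eval_mono m
      (h.trans ((B.isGLB_inf (u.2.image _)).1 ⟨p, hp, rfl⟩)))

theorem zeta1_tmul (a b : B) : zeta1 (Tensor.tmul a b) = a := by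
  change B.inf (Prod.fst '' {(a, b)}) = a
  rw [← B.nu_fst, nu_singleton, B.eval_idEffect, RealEffect.eval_top, B.prod_yes]

theorem zeta2_tmul (a b : B) : zeta2 (Tensor.tmul a b) = b := by
  change B.inf (Prod.snd '' {(a, b)}) = b
  rw [← B.nu_snd, nu_singleton, B.eval_idEffect, RealEffect.eval_top, B.yes_prod]

theorem tmul_bot_ne_bot {s : B} (hs : s ≠ ⊥) : (Tensor.tmul s ⊥ : Tensor B B) ≠ ⊥ := by
  intro h
  have := congrArg zeta1 h
  rw [zeta1_tmul] at this
  exact hs (this.trans (zeta1_tmul ⊥ ⊥))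

theorem bot_tmul_ne_bot {s : B} (hs : s ≠ ⊥) : (Tensor.tmul ⊥ s : Tensor B B) ≠ ⊥ := by
  intro h
  have := congrArg zeta2 h
  rw [zeta2_tmul] at this
  exact hs (this.trans (zeta2_tmul ⊥ ⊥))

theorem pair_le_left (a b a' b' : B) : Tensor.pair a b a' b' ≤ Tensor.tmul a b := by
  intro l m
  change nu l m {(a, b), (a', b')} ≤ nu l m {(a, b)}
  rw [nu_singleton]
  exact (isGLB_nu l m (Set.insert_nonempty _ _)).1 ⟨(a, b), by simp, rfl⟩

theorem pair_le_right (a b a' b' : B) : Tensor.pair a b a' b' ≤ Tensor.tmul a' b' := by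
  intro l m
  change nu l m {(a, b), (a', b')} ≤ nu l m {(a', b')}
  rw [nu_singleton]
  exact (isGLB_nu l m (Set.insert_nonempty _ _)).1 ⟨(a', b'), by simp, rfl⟩

theorem star_le_of_forall (x y : Tensor B B)
    (h : ∀ a b : B, x ≤ Tensor.tmul a b → Tensor.pair (star a) ⊥ ⊥ (star b) ≤ y) :
    star x ≤ y := by
  simp only [star]
  split_ifs with hz
  · refine hz.choose_spec.2 ?_
    rintro _ ⟨a, b, -, -, hab, rfl⟩
    exact h a b hab
  · exact bot_le

theorem B.eq_of_le {s a : B} (hs : s ≠ ⊥) (h : s ≤ a) : a = s :=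
  (h.resolve_left hs).symm

theorem isRealMap_zeta1 : IsRealMap zeta1 := by
  intro l
  refine ⟨⟨l.pos.map (Tensor.tmul · ⊥), l.neg.map (Tensor.tmul · ⊥), ?_⟩, fun x => ?_⟩
  · intro s' hs' t' ht'
    obtain ⟨s, hs, rfl⟩ := Option.mem_map.1 hs'
    obtain ⟨t, ht, rfl⟩ := Option.mem_map.1 ht'
    obtain ⟨h1, h2, h3⟩ := l.compat s hs t ht
    refine ⟨tmul_bot_ne_bot h1, tmul_bot_ne_bot h2, star_le_of_forall _ _ fun a b hab => ?_⟩
    rw [tmul_bot_le_iff, zeta1_tmul] at hab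
    refine (pair_le_left _ _ _ _).trans ?_
    rw [tmul_bot_le_iff, zeta1_tmul, B.eq_of_le h1 hab]
    exact h3
  · have key : ∀ o : Option B, (∃ s ∈ o.map (Tensor.tmul · ⊥), s ≤ x) ↔ ∃ s ∈ o, s ≤ zeta1 x := by
      intro o
      constructor
      · rintro ⟨_, hs, hx⟩
        obtain ⟨s, hs', rfl⟩ := Option.mem_map.1 hs
        exact ⟨s, hs', (tmul_bot_le_iff s x).1 hx⟩
      · rintro ⟨s, hs, hx⟩
        exact ⟨_, Option.mem_map.2 ⟨s, hs, rfl⟩, (tmul_bot_le_iff s x).2 hx⟩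
    exact RealEffect.eval_congr (key l.pos).symm (key l.neg).symm

theorem isRealMap_zeta2 : IsRealMap zeta2 := by
  intro l
  refine ⟨⟨l.pos.map (Tensor.tmul ⊥ ·), l.neg.map (Tensor.tmul ⊥ ·), ?_⟩, fun x => ?_⟩
  · intro s' hs' t' ht'
    obtain ⟨s, hs, rfl⟩ := Option.mem_map.1 hs'
    obtain ⟨t, ht, rfl⟩ := Option.mem_map.1 ht'
    obtain ⟨h1, h2, h3⟩ := l.compat s hs t ht
    refine ⟨bot_tmul_ne_bot h1, bot_tmul_ne_bot h2, star_le_of_forall _ _ fun a b hab => ?_⟩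
    rw [bot_tmul_le_iff, zeta2_tmul] at hab
    refine (pair_le_right _ _ _ _).trans ?_
    rw [bot_tmul_le_iff, zeta2_tmul, B.eq_of_le h1 hab]
    exact h3
  · have key : ∀ o : Option B, (∃ s ∈ o.map (Tensor.tmul ⊥ ·), s ≤ x) ↔ ∃ s ∈ o, s ≤ zeta2 x := by
      intro o
      constructor
      · rintro ⟨_, hs, hx⟩
        obtain ⟨s, hs', rfl⟩ := Option.mem_map.1 hs
        exact ⟨s, hs', (bot_tmul_le_iff s x).1 hx⟩
      · rintro ⟨s, hs, hx⟩
        exact ⟨_, Option.mem_map.2 ⟨s, hs, rfl⟩, (bot_tmul_le_iff s x).2 hx⟩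
    exact RealEffect.eval_congr (key l.pos).symm (key l.neg).symm

/-- The fourth tensor power of `𝔅`; the factors 1, 2 form the first pair and the factors 3, 4
the second pair. -/
abbrev B4 : Type := Tensor (Tensor B B) (Tensor B B)

/-- The marginal `⊓ a₁ ⊗ a₂ ⊗ a₃ ⊗ a₄ ↦ ⊓ a₁ ⊗ a₃`. -/
def zeta13 : B4 → Tensor B B := Tensor.map zeta1 isRealMap_zeta1 zeta1 isRealMap_zeta1

/-- The marginal `⊓ a₁ ⊗ a₂ ⊗ a₃ ⊗ a₄ ↦ ⊓ a₁ ⊗ a₄`. -/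
def zeta14 : B4 → Tensor B B := Tensor.map zeta1 isRealMap_zeta1 zeta2 isRealMap_zeta2

/-- The marginal `⊓ a₁ ⊗ a₂ ⊗ a₃ ⊗ a₄ ↦ ⊓ a₂ ⊗ a₃`. -/
def zeta23 : B4 → Tensor B B := Tensor.map zeta2 isRealMap_zeta2 zeta1 isRealMap_zeta1

/-- The marginal `⊓ a₁ ⊗ a₂ ⊗ a₃ ⊗ a₄ ↦ ⊓ a₂ ⊗ a₄`. -/
def zeta24 : B4 → Tensor B B := Tensor.map zeta2 isRealMap_zeta2 zeta2 isRealMap_zeta2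

/-! ### The ontic completion -/

section Completion

variable {S : Type} [PartialOrder S] [OrderBot S] [Star S]

/-- The preorder `U ⊑ V` on sets of real states: every element of `U` lies below an element
of `V`. -/
def Below (U V : Set S) : Prop := ∀ s ∈ U, ∃ t ∈ V, s ≤ t

/-- The maximal elements among the suprema of the sets `V ⊑ U` which have a supremum (in a space
of real states these are the sets which have an upper bound). -/
def preClosure (U : Set S) : Set S := {s | Maximal (fun z => ∃ V, Below V U ∧ IsLUB V z) s}

/-- The closure `cl_c`: the maximal elements of the union of the iterates `c^n(U)`, `n ≥ 1`. -/
def clc (U : Set S) : Set S := {s | Maximal (fun z => ∃ n : ℕ, 1 ≤ n ∧ z ∈ preClosure^[n] U) s}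

variable (S) in
/-- The consistent sets of non-trivial real states. -/
def consistentSets : Set (Set S) :=
  {U | (∀ s ∈ U, s ≠ ⊥) ∧ ∀ s ∈ U, ∀ t ∈ U, ¬ star s ≤ t}

variable (S) in
/-- The sets whose closure is consistent, together with `{⊥}`. -/
def admissibleSets : Set (Set S) :=
  {U | (∀ s ∈ U, s ≠ ⊥) ∧ clc U ∈ consistentSets S} ∪ {{⊥}}

variable (S) in
/-- The ontic completion, ordered by `Below`. A real state `s` is the element `{s}`; all the
other elements are the hidden states. -/
def Completion : Set (Set S) := clc '' admissibleSets S

/-- A hidden state is an element of the ontic completion which is not a real state. -/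
def IsHidden (J : Set S) : Prop := J ∈ Completion S ∧ ∀ s : S, J ≠ {s}

/-- `J` is the supremum of `J₁` and `J₂` in the ontic completion. -/
def IsJoin (J₁ J₂ J : Set S) : Prop :=
  J ∈ Completion S ∧ Below J₁ J ∧ Below J₂ J ∧
    ∀ K ∈ Completion S, Below J₁ K → Below J₂ K → Below J K

end Completion

/-! ### Bell non-locality -/

section Bell

variable {S T : Type} [PartialOrder S] [OrderBot S] [Star S]
  [PartialOrder T] [OrderBot T] [Star T]

/-- The state `(φ ⊗ ρ)(J)` of the ontic completion of `𝔅 ⊗ 𝔅`, for the real measurements `φ` and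
`ρ` associated with the real effects `l` and `m`, and for a state `J` of the ontic completion of
`S ⊗ T`: the closure of the set of the states `⊓_i φ(a_i) ⊗ ρ(b_i)` such that
`⊓_i a_i ⊗ b_i ∈ J`. -/
def measure (l : RealEffect S) (m : RealEffect T) (J : Set (Tensor S T)) : Set (Tensor B B) :=
  clc {y | ∃ (u : Set (S × T)) (hu : u.Nonempty), Tensor.mk u hu ∈ J ∧
    y = Tensor.mk (Prod.map l.eval m.eval '' u) (hu.image _)}

/-- The four outcomes of the pairs of measurements are the marginals of one state of the fourth
tensor power of `𝔅`. -/
def Reproducible (l₁ l₂ : RealEffect S) (m₁ m₂ : RealEffect T) (J : Set (Tensor S T)) : Prop :=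
  ∃ L : B4, {zeta13 L} = measure l₁ m₁ J ∧ {zeta14 L} = measure l₁ m₂ J ∧
    {zeta23 L} = measure l₂ m₁ J ∧ {zeta24 L} = measure l₂ m₂ J

/-- Bell non-locality of a state of the ontic completion of `S ⊗ T`. -/
def BellNonlocal (J : Set (Tensor S T)) : Prop :=
  ∃ (l₁ l₂ : RealEffect S) (m₁ m₂ : RealEffect T), ¬ Reproducible l₁ l₂ m₁ m₂ J

end Bell

end Ontic

end

namespace Ontic

/-! ### Values of states of a tensor product -/

/-! Everything reduces to the "crosses" `s ⊗ ⊥ ⊓ ⊥ ⊗ t` with `s, t ≠ ⊥`. Such a cross lies below `x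
⊗ y` exactly when `s = x` or `t = y` (`cross_le_tmul`), and if `a ≠ a'`, `b ≠ b'` then `a ⊗ b ⊓ a' ⊗
b'` is the supremum of the crosses of `(a, b')` and `(a', b)` and is generated by them
(`le_of_le_pair`, `isLUB_pair`).

Take the crosses `A`, `B`, `C` of `(σ₁, τ₂)`, `(σ₂, τ₁)`, `(σ₁⋆, τ₁⋆)`. Their first entries are
distinct, and so are their second entries, so a pure tensor matches at most two of them: the three
have no common bound, although any two have a supremum. The given real states are `x = A ⊔ B` and
`C`. Hence the closure of `{x, C}` is `{x, p, q}` with `p = A ⊔ C` and `q = B ⊔ C`; this is the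
hidden state `Σ` (`Triangle`, `triangle_qubit`). Its consistency is again a matching question about
crosses.

Under each of the four measurements the images of `x, p, q` have a greatest element, which is the
outcome. For a joint state `⊓ a₁ ⊗ a₂ ⊗ a₃ ⊗ a₄`, three of the outcomes would say that every term
has `a₁ = N` or `a₃ = N`, `a₁ = Y` or `a₄ = Y`, and `a₂ = Y` or `a₃ = Y`. So every term has `a₂ = Y`
or `a₄ = Y`, which the fourth outcome `⊥ ⊗ ⊥` does not allow (`not_exists_marginals`). -/

theorem B.inf_eq_yes {s : Set B} (hs : s.Nonempty) : B.inf s = B.yes ↔ ∀ x ∈ s, x = B.yes := by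
  constructor
  · intro h x hx
    have := (B.isGLB_inf hs).1 hx
    rw [h] at this
    exact B.eq_of_le (by simp [Bot.bot]) this
  · intro h
    have : s = {B.yes} := Set.eq_singleton_iff_nonempty_unique_mem.2 ⟨hs, h⟩
    simp [B.inf, this]

theorem B.inf_eq_no {s : Set B} (hs : s.Nonempty) : B.inf s = B.no ↔ ∀ x ∈ s, x = B.no := by
  constructor
  · intro h x hx
    have := (B.isGLB_inf hs).1 hx
    rw [h] at this
    exact B.eq_of_le (by simp [Bot.bot]) this
  · intro h
    have : s = {B.no} := Set.eq_singleton_iff_nonempty_unique_mem.2 ⟨hs, h⟩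
    simp [B.inf, this]

theorem B.prod_eq_yes {x y : B} : B.prod x y = B.yes ↔ x = B.yes ∧ y = B.yes := by
  cases x <;> cases y <;> simp [B.prod]

theorem B.prod_eq_no {x y : B} : B.prod x y = B.no ↔ x = B.no ∨ y = B.no := by
  cases x <;> cases y <;> simp [B.prod]

theorem B.le_iff {x y : B} : x ≤ y ↔ (x = B.yes → y = B.yes) ∧ (x = B.no → y = B.no) := by
  change (x = B.bot ∨ x = y) ↔ _
  cases x <;> cases y <;> simp

section Values

variable {S T : Type} [PartialOrder S] [OrderBot S] [Star S]
  [PartialOrder T] [OrderBot T] [Star T]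

theorem Tensor.ind_mk {p : Tensor S T → Prop} (h : ∀ u hu, p (Tensor.mk u hu))
    (x : Tensor S T) : p x := by
  induction x using Quotient.inductionOn with | _ u => exact h u.1 u.2

theorem Tensor.value_mk_eq_yes {l : RealEffect S} {m : RealEffect T} {u : Set (S × T)}
    {hu : u.Nonempty} : (Tensor.mk u hu).value l m = B.yes ↔
      ∀ p ∈ u, l.eval p.1 = B.yes ∧ m.eval p.2 = B.yes := by
  change B.inf _ = _ ↔ _
  rw [B.inf_eq_yes (hu.image _)]
  simp only [Set.forall_mem_image, B.prod_eq_yes]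

/-- Because `N` is absorbing, the value `N` is a disjunction at each pair; the value `Y` is a
conjunction. -/
theorem Tensor.value_mk_eq_no {l : RealEffect S} {m : RealEffect T} {u : Set (S × T)}
    {hu : u.Nonempty} : (Tensor.mk u hu).value l m = B.no ↔
      ∀ p ∈ u, l.eval p.1 = B.no ∨ m.eval p.2 = B.no := by
  change B.inf _ = _ ↔ _
  rw [B.inf_eq_no (hu.image _)]
  simp only [Set.forall_mem_image, B.prod_eq_no]

theorem Tensor.value_pair_eq_yes {l : RealEffect S} {m : RealEffect T} {a a' : S} {b b' : T} :
    (Tensor.pair a b a' b').value l m = B.yes ↔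
      (l.eval a = B.yes ∧ m.eval b = B.yes) ∧ l.eval a' = B.yes ∧ m.eval b' = B.yes := by
  simp [Tensor.pair, Tensor.value_mk_eq_yes]

theorem Tensor.value_pair_eq_no {l : RealEffect S} {m : RealEffect T} {a a' : S} {b b' : T} :
    (Tensor.pair a b a' b').value l m = B.no ↔
      (l.eval a = B.no ∨ m.eval b = B.no) ∧ (l.eval a' = B.no ∨ m.eval b' = B.no) := by
  simp [Tensor.pair, Tensor.value_mk_eq_no]

theorem Tensor.value_tmul_eq_yes {l : RealEffect S} {m : RealEffect T} {a : S} {b : T} :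
    (Tensor.tmul a b).value l m = B.yes ↔ l.eval a = B.yes ∧ m.eval b = B.yes := by
  simp [Tensor.tmul, Tensor.value_mk_eq_yes]

theorem Tensor.value_tmul_eq_no {l : RealEffect S} {m : RealEffect T} {a : S} {b : T} :
    (Tensor.tmul a b).value l m = B.no ↔ l.eval a = B.no ∨ m.eval b = B.no := by
  simp [Tensor.tmul, Tensor.value_mk_eq_no]

theorem Tensor.le_iff {x y : Tensor S T} : x ≤ y ↔ ∀ (l : RealEffect S) (m : RealEffect T),
    (x.value l m = B.yes → y.value l m = B.yes) ∧ (x.value l m = B.no → y.value l m = B.no) :=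
  forall₂_congr fun _ _ => B.le_iff

theorem Tensor.mk_le_tmul {u : Set (S × T)} (hu : u.Nonempty) {p : S × T} (hp : p ∈ u) :
    Tensor.mk u hu ≤ Tensor.tmul p.1 p.2 := by
  rw [Tensor.le_iff]
  intro l m
  rw [Tensor.value_mk_eq_yes, Tensor.value_mk_eq_no, Tensor.value_tmul_eq_yes,
    Tensor.value_tmul_eq_no]
  exact ⟨fun h => h p hp, fun h => h p hp⟩

theorem Tensor.exists_le_tmul (x : Tensor S T) : ∃ a b, x ≤ Tensor.tmul a b := by
  induction x using Tensor.ind_mk with | _ u hu => ?_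
  obtain ⟨p, hp⟩ := hu
  exact ⟨p.1, p.2, Tensor.mk_le_tmul ⟨p, hp⟩ hp⟩

/-- Together with `Tensor.mk_le_tmul` this makes `Tensor.mk u hu` the infimum of its tensors, so
inequalities into it are checked one tensor at a time. -/
theorem Tensor.le_mk {x : Tensor S T} {u : Set (S × T)} {hu : u.Nonempty}
    (h : ∀ p ∈ u, x ≤ Tensor.tmul p.1 p.2) : x ≤ Tensor.mk u hu := by
  rw [Tensor.le_iff]
  intro l m
  rw [Tensor.value_mk_eq_yes, Tensor.value_mk_eq_no]
  refine ⟨fun hx p hp => ?_, fun hx p hp => ?_⟩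
  · exact Tensor.value_tmul_eq_yes.1 ((Tensor.le_iff.1 (h p hp) l m).1 hx)
  · exact Tensor.value_tmul_eq_no.1 ((Tensor.le_iff.1 (h p hp) l m).2 hx)

/-- Since non-empty sets have infima, bounded sets have suprema. -/
theorem Tensor.exists_isLUB {W : Set (Tensor S T)} (hW : BddAbove W) : ∃ z, IsLUB W z := by
  obtain ⟨x, hx⟩ := hW
  -- The union of all representatives of all upper bounds: its class is their infimum.
  set u : Set (S × T) := {p | ∃ v hv, Tensor.mk v hv ∈ upperBounds W ∧ p ∈ v} with hu_def
  have hu : u.Nonempty := by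
    induction x using Tensor.ind_mk with | _ v hv => ?_
    obtain ⟨p, hp⟩ := hv
    exact ⟨p, v, ⟨p, hp⟩, hx, hp⟩
  refine ⟨Tensor.mk u hu, fun w hw => Tensor.le_mk ?_, fun y hy => ?_⟩
  · rintro p ⟨v, hv, hvW, hp⟩
    exact (hvW hw).trans (Tensor.mk_le_tmul hv hp)
  · induction y using Tensor.ind_mk with | _ v hv => ?_
    exact Tensor.le_mk fun p hp => Tensor.mk_le_tmul hu ⟨v, hv, hy, hp⟩

/-- The star takes the default value `⊥` if its defining supremum fails to exist. The bound `z`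
excludes this, since bounded sets have suprema. -/
theorem Tensor.pair_star_le {x z v : Tensor S T}
    (hz : ∀ a b, IsMax a → IsMax b → x ≤ Tensor.tmul a b →
      Tensor.pair (star a) ⊥ ⊥ (star b) ≤ z)
    (hv : star x ≤ v) {a : S} {b : T} (ha : IsMax a) (hb : IsMax b)
    (hx : x ≤ Tensor.tmul a b) : Tensor.pair (star a) ⊥ ⊥ (star b) ≤ v := by
  have hW : ∃ y, IsLUB {y : Tensor S T | ∃ (a : S) (b : T), IsMax a ∧ IsMax b ∧
      x ≤ Tensor.tmul a b ∧ y = Tensor.pair (star a) ⊥ ⊥ (star b)} y := by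
    refine Tensor.exists_isLUB ⟨z, ?_⟩
    rintro _ ⟨a, b, ha, hb, hab, rfl⟩
    exact hz a b ha hb hab
  refine le_trans ?_ hv
  simp only [star]
  rw [dif_pos hW]
  exact hW.choose_spec.1 ⟨a, b, ha, hb, hx, rfl⟩

instance [Finite S] [Finite T] : Finite (Tensor S T) := by
  unfold Tensor
  infer_instance

end Values

/-! ### Flat spaces -/

/-- An order with bottom in which every other element is both minimal above `⊥` and maximal. -/
def IsFlat (S : Type) [PartialOrder S] [OrderBot S] : Prop :=
  ∀ ⦃x y : S⦄, x ≤ y → x = ⊥ ∨ x = y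

theorem B.isFlat : IsFlat B := fun _ _ h => h

theorem Qubit.isFlat (N : ℕ) : IsFlat (Qubit N) := fun _ _ h => h

/-- The real effect `𝔩_(·,s)`. -/
def RealEffect.negOnly {S : Type} [PartialOrder S] [OrderBot S] [Star S] (s : S) :
    RealEffect S where
  pos := none
  neg := some s
  compat := by simp

section Flat

variable {S T : Type} [PartialOrder S] [OrderBot S] [Star S]
  [PartialOrder T] [OrderBot T] [Star T]

theorem RealEffect.eval_negOnly {s x : S} : (RealEffect.negOnly s).eval x = B.no ↔ s ≤ x := by
  unfold RealEffect.eval RealEffect.negOnly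
  split_ifs <;> simp_all

/-- Only `⊥` lies below two distinct elements of a flat space, so a label of the effect that is
below both is `⊥`. Hence an effect taking the same value `Y` or `N` at two distinct elements is
constant. -/
theorem RealEffect.eval_bot_of_eval_eq (hS : IsFlat S) (l : RealEffect S) {a a' : S} {c : B}
    (h : a ≠ a') (ha : l.eval a = c) (ha' : l.eval a' = c) : l.eval ⊥ = c := by
  have key : ∀ s, s ≤ a → s ≤ a' → s ≤ ⊥ := by
    intro s h1 h2
    rcases hS h1 with rfl | rfl
    · exact le_rfl
    · rcases hS h2 with rfl | rfl
      · exact le_rfl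
      · exact absurd rfl h
  have hle := l.eval_bot_le a
  rw [ha] at hle
  cases c with
  | bot => exact le_bot_iff.1 hle
  | yes =>
    have hpos : ∀ x, l.eval x = B.yes ↔ ∃ s ∈ l.pos, s ≤ x := by
      intro x; unfold RealEffect.eval; split_ifs <;> simp_all
    rw [hpos] at *
    obtain ⟨s, hs, h1⟩ := ha
    obtain ⟨s', hs', h2⟩ := ha'
    obtain rfl : s = s' := Option.mem_unique hs hs'
    exact ⟨s, hs, key s h1 h2⟩
  | no =>
    have hneg : ∀ x, l.eval x = B.no ↔ (¬ ∃ s ∈ l.pos, s ≤ x) ∧ ∃ s ∈ l.neg, s ≤ x := by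
      intro x; unfold RealEffect.eval; split_ifs <;> simp_all
    rw [hneg] at *
    obtain ⟨h0, s, hs, h1⟩ := ha
    obtain ⟨-, s', hs', h2⟩ := ha'
    obtain rfl : s = s' := Option.mem_unique hs hs'
    refine ⟨?_, s, hs, key s h1 h2⟩
    rintro ⟨t, ht, ht'⟩
    exact h0 ⟨t, ht, ht'.trans bot_le⟩

theorem RealEffect.eval_eq_of_eval_bot (l : RealEffect S) {c : B} (hc : c ≠ B.bot)
    (h : l.eval ⊥ = c) (x : S) : l.eval x = c :=
  B.eq_of_le hc (h ▸ l.eval_bot_le x)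

theorem RealEffect.le_or_eval_bot_of_eval_eq_no (hS : IsFlat S) {l : RealEffect S} {a x : S}
    (ha : l.eval a = B.no) (hx : l.eval x = B.no) : a ≤ x ∨ l.eval ⊥ = B.no := by
  by_cases h : a = x
  · exact Or.inl h.le
  · exact Or.inr (l.eval_bot_of_eval_eq hS h ha hx)

theorem cross_le_tmul (hS : IsFlat S) (hT : IsFlat T) {a x : S} {b y : T}
    (ha : a ≠ ⊥) (hb : b ≠ ⊥) :
    Tensor.pair a ⊥ ⊥ b ≤ Tensor.tmul x y ↔ a = x ∨ b = y := by
  constructor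
  · intro h
    -- This pair of effects has value `N` on both terms of the cross, through the first factor on
    -- one and the second on the other.
    have := (Tensor.le_iff.1 h (RealEffect.negOnly a) (RealEffect.negOnly b)).2
    rw [Tensor.value_pair_eq_no, Tensor.value_tmul_eq_no] at this
    simp only [RealEffect.eval_negOnly] at this
    rcases this ⟨Or.inl le_rfl, Or.inr le_rfl⟩ with h | h
    · exact Or.inl ((hS h).resolve_left ha)
    · exact Or.inr ((hT h).resolve_left hb)
  · have hl := fun (l : RealEffect S) => l.eval_bot_le x
    have hm := fun (m : RealEffect T) => m.eval_bot_le y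
    simp only [B.le_iff] at hl hm
    intro h
    rw [Tensor.le_iff]
    intro l m
    rw [Tensor.value_pair_eq_no, Tensor.value_tmul_eq_no, Tensor.value_pair_eq_yes,
      Tensor.value_tmul_eq_yes]
    have := hl l
    have := hm m
    rcases h with rfl | rfl <;> grind

theorem Tensor.le_pair {x : Tensor S T} {a a' : S} {b b' : T} :
    x ≤ Tensor.pair a b a' b' ↔ x ≤ Tensor.tmul a b ∧ x ≤ Tensor.tmul a' b' := by
  constructor
  · intro h
    exact ⟨h.trans (Tensor.mk_le_tmul (p := (a, b)) _ (by simp)),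
      h.trans (Tensor.mk_le_tmul (p := (a', b')) _ (by simp))⟩
  · rintro ⟨h1, h2⟩
    refine Tensor.le_mk ?_
    rintro p (rfl | rfl)
    · exact h1
    · exact h2

/-- A state below `a ⊗ b ⊓ a' ⊗ b'` is generated by the states `a ⊗ ⊥ ⊓ ⊥ ⊗ b'` and
`a' ⊗ ⊥ ⊓ ⊥ ⊗ b` as far as they lie below it. -/
theorem le_of_le_pair (hS : IsFlat S) (hT : IsFlat T) {a a' : S} {b b' : T}
    (hab : a ≠ a') (hbb : b ≠ b') {v w : Tensor S T}
    (hv : v ≤ Tensor.pair a b a' b')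
    (h1 : Tensor.pair a ⊥ ⊥ b' ≤ v → Tensor.pair a ⊥ ⊥ b' ≤ w)
    (h2 : Tensor.pair a' ⊥ ⊥ b ≤ v → Tensor.pair a' ⊥ ⊥ b ≤ w) : v ≤ w := by
  -- If neither effect is constantly `N`, the value `N` at a term of `v` forces its first entry to
  -- be `s` or its second to be `t`. The cross of `(s, t)` is then below `v`, hence below `w`, and
  -- carries the value `N` over.
  have cross : ∀ (l : RealEffect S) (m : RealEffect T) (s : S) (t : T),
      v.value l m = B.no → l.eval s = B.no → m.eval t = B.no →
      (Tensor.pair s ⊥ ⊥ t ≤ v → Tensor.pair s ⊥ ⊥ t ≤ w) → w.value l m = B.no := by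
    intro l m s t hvn hls hmt himp
    by_cases hl : l.eval ⊥ = B.no
    · induction w using Tensor.ind_mk with | _ u hu => ?_
      exact Tensor.value_mk_eq_no.2 fun p _ =>
        Or.inl (l.eval_eq_of_eval_bot (by simp) hl _)
    by_cases hm : m.eval ⊥ = B.no
    · induction w using Tensor.ind_mk with | _ u hu => ?_
      exact Tensor.value_mk_eq_no.2 fun p _ =>
        Or.inr (m.eval_eq_of_eval_bot (by simp) hm _)
    refine (Tensor.le_iff.1 (himp ?_) l m).2 (Tensor.value_pair_eq_no.2 ⟨Or.inl hls, Or.inr hmt⟩)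
    have hs : s ≠ ⊥ := fun h => hl (h ▸ hls)
    have ht : t ≠ ⊥ := fun h => hm (h ▸ hmt)
    induction v using Tensor.ind_mk with | _ u hu => ?_
    refine Tensor.le_mk fun p hp => ?_
    rw [cross_le_tmul hS hT hs ht]
    rcases Tensor.value_mk_eq_no.1 hvn p hp with h | h
    · exact Or.inl ((hS ((RealEffect.le_or_eval_bot_of_eval_eq_no hS hls h).resolve_right
        hl)).resolve_left hs)
    · exact Or.inr ((hT ((RealEffect.le_or_eval_bot_of_eval_eq_no hT hmt h).resolve_right
        hm)).resolve_left ht)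
  rw [Tensor.le_iff]
  intro l m
  obtain ⟨hy, hn⟩ := Tensor.le_iff.1 hv l m
  refine ⟨fun h => ?_, fun h => ?_⟩
  -- The value `Y` on two tensors with distinct entries makes both effects constant.
  · obtain ⟨⟨e1, e2⟩, e3, e4⟩ := Tensor.value_pair_eq_yes.1 (hy h)
    induction w using Tensor.ind_mk with | _ u hu => ?_
    exact Tensor.value_mk_eq_yes.2 fun p _ =>
      ⟨l.eval_eq_of_eval_bot (by simp) (l.eval_bot_of_eval_eq hS hab e1 e3) _,
        m.eval_eq_of_eval_bot (by simp) (m.eval_bot_of_eval_eq hT hbb e2 e4) _⟩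
  -- If the same factor gives `N` on both tensors, its effect is constant; the two mixed cases are
  -- the two crosses.
  · obtain ⟨e1 | e1, e2 | e2⟩ := Tensor.value_pair_eq_no.1 (hn h)
    · have hl := l.eval_bot_of_eval_eq hS hab e1 e2
      induction w using Tensor.ind_mk with | _ u hu => ?_
      exact Tensor.value_mk_eq_no.2 fun p _ => Or.inl (l.eval_eq_of_eval_bot (by simp) hl _)
    · exact cross l m a b' h e1 e2 h1
    · exact cross l m a' b h e2 e1 h2
    · have hm := m.eval_bot_of_eval_eq hT hbb e1 e2
      induction w using Tensor.ind_mk with | _ u hu => ?_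
      exact Tensor.value_mk_eq_no.2 fun p _ => Or.inr (m.eval_eq_of_eval_bot (by simp) hm _)

theorem isLUB_pair (hS : IsFlat S) (hT : IsFlat T) {a a' : S} {b b' : T}
    (hab : a ≠ a') (hbb : b ≠ b') (ha : a ≠ ⊥) (ha' : a' ≠ ⊥) (hb : b ≠ ⊥) (hb' : b' ≠ ⊥) :
    IsLUB {Tensor.pair a ⊥ ⊥ b', Tensor.pair a' ⊥ ⊥ b} (Tensor.pair a b a' b') := by
  constructor
  · rintro _ (rfl | rfl)
    · rw [Tensor.le_pair, cross_le_tmul hS hT ha hb', cross_le_tmul hS hT ha hb']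
      exact ⟨Or.inl rfl, Or.inr rfl⟩
    · rw [Tensor.le_pair, cross_le_tmul hS hT ha' hb, cross_le_tmul hS hT ha' hb]
      exact ⟨Or.inr rfl, Or.inl rfl⟩
  · intro w hw
    exact le_of_le_pair hS hT hab hbb le_rfl (fun _ => hw (by simp)) (fun _ => hw (by simp))

end Flat

/-! ### Closures in the ontic completion -/

section Closure

variable {S : Type} [PartialOrder S]

theorem Below.trans {U V W : Set S} (h : Below U V) (h' : Below V W) : Below U W := by
  intro s hs
  obtain ⟨t, ht, hst⟩ := h s hs
  obtain ⟨r, hr, htr⟩ := h' t ht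
  exact ⟨r, hr, hst.trans htr⟩

/-- Both `preClosure` and `clc` consist of maximal elements, so each can be computed by exhibiting a
cofinal antichain. -/
theorem setOf_maximal_eq {Z J : Set S} (hJ : IsAntichain (· ≤ ·) J) (hJZ : J ⊆ Z)
    (hZJ : Below Z J) : {s | Maximal (· ∈ Z) s} = J := by
  ext s
  constructor
  · rintro ⟨hs, hmax⟩
    obtain ⟨j, hj, hsj⟩ := hZJ s hs
    exact (le_antisymm hsj (hmax (hJZ hj) hsj)) ▸ hj
  · intro hs
    refine ⟨hJZ hs, fun z hz hsz => ?_⟩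
    obtain ⟨j, hj, hzj⟩ := hZJ z hz
    rw [hJ.eq hs hj (hsz.trans hzj)]
    exact hzj

theorem clc_eq_of_preClosure_eq {U J : Set S} (hJ : IsAntichain (· ≤ ·) J)
    (hU : preClosure U = J) (hJJ : preClosure J = J) : clc U = J := by
  have hit : ∀ n : ℕ, preClosure^[n + 1] U = J := by
    intro n
    induction n with
    | zero => exact hU
    | succ n ih => rw [Function.iterate_succ_apply', ih, hJJ]
  refine setOf_maximal_eq (Z := {z | ∃ n : ℕ, 1 ≤ n ∧ z ∈ preClosure^[n] U}) hJ ?_ ?_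
  · exact fun s hs => ⟨1, le_rfl, by rw [hit 0]; exact hs⟩
  · rintro s ⟨n, hn, hs⟩
    obtain ⟨k, rfl⟩ := Nat.exists_eq_add_of_le' hn
    rw [hit k] at hs
    exact ⟨s, hs, le_rfl⟩

theorem preClosure_eq_singleton {U : Set S} {g : S} (hg : g ∈ U) (hU : ∀ u ∈ U, u ≤ g) :
    preClosure U = {g} := by
  refine setOf_maximal_eq (Z := {z | ∃ V, Below V U ∧ IsLUB V z})
    (by simp) ?_ ?_
  · rw [Set.singleton_subset_iff]
    exact ⟨{g}, by rintro _ rfl; exact ⟨_, hg, le_rfl⟩, isLUB_singleton⟩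
  · rintro z ⟨V, hV, hz⟩
    refine ⟨g, rfl, hz.2 fun v hv => ?_⟩
    obtain ⟨u, hu, hvu⟩ := hV v hv
    exact hvu.trans (hU u hu)

theorem clc_eq_singleton {U : Set S} {g : S} (hg : g ∈ U) (hU : ∀ u ∈ U, u ≤ g) :
    clc U = {g} :=
  clc_eq_of_preClosure_eq (by simp) (preClosure_eq_singleton hg hU)
    (preClosure_eq_singleton rfl (by simp))

/-- Finiteness guarantees that passing to maximal elements loses nothing up to domination. -/
theorem below_preClosure_of_isLUB [Finite S] {U V : Set S} {z : S} (hV : Below V U)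
    (hz : IsLUB V z) : ∃ t ∈ preClosure U, z ≤ t := by
  obtain ⟨t, hzt, ht⟩ := (Set.toFinite {z | ∃ V, Below V U ∧ IsLUB V z}).exists_le_maximal
    (show z ∈ {z | ∃ V, Below V U ∧ IsLUB V z} from ⟨V, hV, hz⟩)
  exact ⟨t, ht, hzt⟩

theorem below_preClosure [Finite S] (U : Set S) : Below U (preClosure U) := fun s hs =>
  below_preClosure_of_isLUB (V := {s}) (by rintro _ rfl; exact ⟨_, hs, le_rfl⟩) isLUB_singleton

theorem below_iterate_preClosure [Finite S] (U : Set S) {m n : ℕ} (h : m ≤ n) :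
    Below (preClosure^[m] U) (preClosure^[n] U) := by
  induction n, h using Nat.le_induction with
  | base => exact fun s hs => ⟨s, hs, le_rfl⟩
  | succ n _ ih =>
    rw [Function.iterate_succ_apply']
    exact ih.trans (below_preClosure _)

/-- The closure absorbs the supremum of two elements below it. -/
theorem exists_le_clc_of_isLUB_pair [Finite S] {U : Set S} {a b z : S} (hz : IsLUB {a, b} z)
    (ha : ∃ t ∈ clc U, a ≤ t) (hb : ∃ t ∈ clc U, b ≤ t) : ∃ t ∈ clc U, z ≤ t := by
  obtain ⟨s, ⟨⟨m, hm, hs⟩, -⟩, has⟩ := ha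
  obtain ⟨t, ⟨⟨n, hn, ht⟩, -⟩, hbt⟩ := hb
  obtain ⟨s', hs', hss⟩ := below_iterate_preClosure U (le_max_left m n) s hs
  obtain ⟨t', ht', htt⟩ := below_iterate_preClosure U (le_max_right m n) t ht
  -- The two bounds may arise at different iterates. At stage `max m n` both are available, and one
  -- further step absorbs the supremum.
  have hV : Below {a, b} (preClosure^[max m n] U) := by
    rintro _ (rfl | rfl)
    · exact ⟨s', hs', has.trans hss⟩
    · exact ⟨t', ht', hbt.trans htt⟩
  obtain ⟨r, hr, hzr⟩ := below_preClosure_of_isLUB hV hz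
  rw [← Function.iterate_succ_apply' preClosure] at hr
  obtain ⟨q, hrq, hq⟩ := (Set.toFinite {z | ∃ n : ℕ, 1 ≤ n ∧ z ∈ preClosure^[n] U}).exists_le_maximal
    (show r ∈ {z | ∃ n : ℕ, 1 ≤ n ∧ z ∈ preClosure^[n] U} from ⟨_, Nat.succ_pos _, hr⟩)
  exact ⟨q, hq, hzr.trans hrq⟩

/-- Three unbounded elements `a`, `b`, `c` with pairwise suprema `x`, `p`, `q` which generate
everything below these suprema. -/
structure Triangle (a b c x p q : S) : Prop where
  lub_x : IsLUB {a, b} x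
  lub_p : IsLUB {a, c} p
  lub_q : IsLUB {b, c} q
  unbounded : ∀ z, a ≤ z → b ≤ z → c ≤ z → False
  gen : ∀ v w, (v ≤ x ∨ v ≤ p ∨ v ≤ q) → (a ≤ v → a ≤ w) → (b ≤ v → b ≤ w) →
    (c ≤ v → c ≤ w) → v ≤ w

namespace Triangle

variable {a b c x p q : S} (h : Triangle a b c x p q)
include h

theorem le : a ≤ x ∧ b ≤ x ∧ a ≤ p ∧ c ≤ p ∧ b ≤ q ∧ c ≤ q :=
  ⟨h.lub_x.1 (by simp), h.lub_x.1 (by simp), h.lub_p.1 (by simp), h.lub_p.1 (by simp),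
    h.lub_q.1 (by simp), h.lub_q.1 (by simp)⟩

/-- Any two of `x, p, q` together dominate `a, b, c`, so a comparison between them would produce a
common bound. -/
theorem isAntichain : IsAntichain (· ≤ ·) ({x, p, q} : Set S) := by
  obtain ⟨h1, h2, h3, h4, h5, h6⟩ := h.le
  rintro s (rfl | rfl | rfl) t (rfl | rfl | rfl) hne hle
  · exact hne rfl
  · exact h.unbounded _ h3 (h2.trans hle) h4
  · exact h.unbounded _ (h1.trans hle) h5 h6
  · exact h.unbounded _ h1 h2 (h4.trans hle)
  · exact hne rfl
  · exact h.unbounded _ (h3.trans hle) h5 h6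
  · exact h.unbounded _ h1 h2 (h6.trans hle)
  · exact h.unbounded _ h3 (h5.trans hle) h4
  · exact hne rfl

/-- A set `V` with a supremum cannot dominate all three generators. It misses one of them, and `gen`
then bounds `V` by the supremum of the other two. The hypotheses on `U` cover both `{x, c}` and `{x,
p, q}`, so the closure stabilises after one step. -/
theorem preClosure_eq {U : Set S} (hxU : ∃ t ∈ U, x ≤ t) (hcU : ∃ t ∈ U, c ≤ t)
    (hU : Below U {x, p, q}) : preClosure U = {x, p, q} := by
  obtain ⟨h1, h2, h3, h4, h5, h6⟩ := h.le
  obtain ⟨s, hs, hxs⟩ := hxU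
  obtain ⟨t, ht, hct⟩ := hcU
  refine setOf_maximal_eq (Z := {z | ∃ V, Below V U ∧ IsLUB V z}) h.isAntichain ?_ ?_
  · rintro _ (rfl | rfl | rfl)
    · refine ⟨{a, b}, ?_, h.lub_x⟩
      rintro _ (rfl | rfl)
      · exact ⟨s, hs, h1.trans hxs⟩
      · exact ⟨s, hs, h2.trans hxs⟩
    · refine ⟨{a, c}, ?_, h.lub_p⟩
      rintro _ (rfl | rfl)
      · exact ⟨s, hs, h1.trans hxs⟩
      · exact ⟨t, ht, hct⟩
    · refine ⟨{b, c}, ?_, h.lub_q⟩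
      rintro _ (rfl | rfl)
      · exact ⟨s, hs, h2.trans hxs⟩
      · exact ⟨t, ht, hct⟩
  · rintro z ⟨V, hV, hz⟩
    have hVJ : ∀ v ∈ V, v ≤ x ∨ v ≤ p ∨ v ≤ q := by
      intro v hv
      obtain ⟨r, hr, hvr⟩ := hV.trans hU v hv
      rcases hr with rfl | rfl | rfl
      · exact Or.inl hvr
      · exact Or.inr (Or.inl hvr)
      · exact Or.inr (Or.inr hvr)
    by_cases hc : ∃ v ∈ V, c ≤ v
    · by_cases hb : ∃ v ∈ V, b ≤ v
      · by_cases ha : ∃ v ∈ V, a ≤ v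
        · obtain ⟨u, hu, hau⟩ := ha
          obtain ⟨v, hv, hbv⟩ := hb
          obtain ⟨w, hw, hcw⟩ := hc
          exact (h.unbounded z (hau.trans (hz.1 hu)) (hbv.trans (hz.1 hv))
            (hcw.trans (hz.1 hw))).elim
        · refine ⟨q, by simp, hz.2 fun v hv => h.gen v q (hVJ v hv) ?_ (fun _ => h5) fun _ => h6⟩
          exact fun hav => absurd ⟨v, hv, hav⟩ ha
      · refine ⟨p, by simp, hz.2 fun v hv => h.gen v p (hVJ v hv) (fun _ => h3) ?_ fun _ => h4⟩
        exact fun hbv => absurd ⟨v, hv, hbv⟩ hb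
    · refine ⟨x, by simp, hz.2 fun v hv => h.gen v x (hVJ v hv) (fun _ => h1) (fun _ => h2) ?_⟩
      exact fun hcv => absurd ⟨v, hv, hcv⟩ hc

theorem clc_eq : clc {x, c} = {x, p, q} := by
  obtain ⟨h1, h2, h3, h4, h5, h6⟩ := h.le
  refine clc_eq_of_preClosure_eq h.isAntichain
    (h.preClosure_eq ⟨x, by simp, le_rfl⟩ ⟨c, by simp, le_rfl⟩ ?_)
    (h.preClosure_eq ⟨x, by simp, le_rfl⟩ ⟨p, by simp, h4⟩ fun s hs => ⟨s, hs, le_rfl⟩)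
  rintro _ (rfl | rfl)
  · exact ⟨_, by simp, le_rfl⟩
  · exact ⟨p, by simp, h4⟩

/-- An element of the completion above `{x}` and `{c}` dominates `a`, `b` and `c`; being a closure,
it absorbs the suprema `p` and `q`. -/
theorem isJoin [Finite S] [OrderBot S] [Star S] (hJ : {x, p, q} ∈ Completion S) :
    IsJoin {x} {c} {x, p, q} := by
  obtain ⟨h1, h2, h3, h4, h5, h6⟩ := h.le
  refine ⟨hJ, ?_, ?_, ?_⟩
  · rintro _ rfl
    exact ⟨_, by simp, le_rfl⟩
  · rintro _ rfl
    exact ⟨p, by simp, h4⟩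
  · rintro _ ⟨W, -, rfl⟩ hx hc
    obtain ⟨s, hs, hxs⟩ := hx x rfl
    have hc' := hc c rfl
    rintro _ (rfl | rfl | rfl)
    · exact ⟨s, hs, hxs⟩
    · exact exists_le_clc_of_isLUB_pair h.lub_p ⟨s, hs, h1.trans hxs⟩ hc'
    · exact exists_le_clc_of_isLUB_pair h.lub_q ⟨s, hs, h2.trans hxs⟩ hc'

theorem isHidden [OrderBot S] [Star S] (hJ : {x, p, q} ∈ Completion S) :
    IsHidden ({x, p, q} : Set S) := by
  refine ⟨hJ, fun s hs => ?_⟩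
  obtain ⟨h1, h2, h3, h4, h5, h6⟩ := h.le
  have hx : x ∈ ({s} : Set S) := hs ▸ by simp
  have hp : p ∈ ({s} : Set S) := hs ▸ by simp
  obtain rfl := hx
  obtain rfl := hp
  exact h.unbounded _ h1 h2 h4

end Triangle

end Closure

/-! ### Tensor products of the spaces `Z'_N` -/

instance (N : ℕ) : Finite (Qubit N) :=
  Finite.of_surjective (fun o : Option (Fin N × Bool) => o.elim Qubit.bot fun p => .pure p.1 p.2)
    fun x => by
      cases x with
      | bot => exact ⟨none, rfl⟩
      | pure i b => exact ⟨some (i, b), rfl⟩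

theorem Qubit.star_star {N : ℕ} (x : Qubit N) : star (star x) = x := by
  cases x <;> simp [star]

theorem Qubit.star_inj {N : ℕ} {x y : Qubit N} : star x = star y ↔ x = y :=
  ⟨fun h => by rw [← star_star x, h, star_star], fun h => h ▸ rfl⟩

theorem Qubit.star_ne_self {N : ℕ} {x : Qubit N} (hx : x ≠ ⊥) : star x ≠ x := by
  rcases x with _ | ⟨i, b⟩
  · exact absurd rfl hx
  · simp [star]

theorem Qubit.isMax {N : ℕ} {x : Qubit N} (hx : x ≠ ⊥) : IsMax x := by
  intro y hy
  exact ((Qubit.isFlat N hy).resolve_left hx).ge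

theorem Qubit.exists_pure_ne {N : ℕ} (hN : 2 ≤ N) : ∃ x y : Qubit N, x ≠ ⊥ ∧ y ≠ ⊥ ∧ x ≠ y ∧
    x ≠ star y := by
  refine ⟨.pure ⟨0, by omega⟩ false, .pure ⟨1, by omega⟩ false, ?_⟩
  simp [Bot.bot, star]

theorem Qubit.ne_bot_of_isMax {N : ℕ} {s x : Qubit N} (hs : s ≠ ⊥) (hx : IsMax x) : x ≠ ⊥ := by
  rintro rfl
  exact hs (le_bot_iff.1 (hx bot_le))

theorem Qubit.eval_effect_self {N : ℕ} {x : Qubit N} (hx : x ≠ ⊥) :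
    (x.effect hx).eval x = B.yes := by
  simp [RealEffect.eval, Qubit.effect, RealEffect.ofState]

theorem Qubit.eval_effect_star {N : ℕ} {x : Qubit N} (hx : x ≠ ⊥) :
    (x.effect hx).eval (star x) = B.no := by
  have : ¬ x ≤ star x := fun h => star_ne_self hx ((Qubit.isFlat N h).resolve_left hx).symm
  simp [RealEffect.eval, Qubit.effect, RealEffect.ofState, this]

theorem Qubit.eval_effect_of_ne {N : ℕ} {x y : Qubit N} (hx : x ≠ ⊥) (h : x ≠ y)
    (h' : star x ≠ y) : (x.effect hx).eval y = B.bot := by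
  have h1 : ¬ x ≤ y := fun e => h ((Qubit.isFlat N e).resolve_left hx)
  have h2 : ¬ star x ≤ y := fun e => h' ((Qubit.isFlat N e).resolve_left (star_ne_bot hx))
  simp [RealEffect.eval, Qubit.effect, RealEffect.ofState, h1, h2]

/-- The map `f` sending `Y`, `N` to `x`, `star x` is the lower adjoint of the measurement. Effects
of `B` are pulled back by applying `f` to their labels, and `f` respects the star. -/
theorem isRealMap_effect {N : ℕ} {x : Qubit N} (hx : x ≠ ⊥) : IsRealMap (x.effect hx).eval := by
  have hsx := Qubit.star_ne_bot hx
  let f : B → Qubit N := fun b => match b with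
    | B.bot => ⊥
    | B.yes => x
    | B.no => star x
  have hf : ∀ b y, f b ≤ y ↔ b ≤ (x.effect hx).eval y := by
    intro b y
    have hy : x ≤ y ∨ star x ≤ y ∨ (¬ x ≤ y ∧ ¬ star x ≤ y) := by tauto
    rcases hy with h | h | h
    · obtain rfl := (Qubit.isFlat N h).resolve_left hx
      rw [Qubit.eval_effect_self, B.le_iff]
      cases b <;> simp [f]
      exact fun h => Qubit.star_ne_self hx ((Qubit.isFlat N h).resolve_left hsx)
    · obtain rfl := (Qubit.isFlat N h).resolve_left hsx
      rw [Qubit.eval_effect_star, B.le_iff]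
      cases b <;> simp [f]
      exact fun h => Qubit.star_ne_self hx ((Qubit.isFlat N h).resolve_left hx).symm
    · rw [Qubit.eval_effect_of_ne hx (fun e => h.1 e.le) (fun e => h.2 e.le), B.le_iff]
      cases b <;> simp [f, h.1, h.2]
  intro l
  refine ⟨⟨l.pos.map f, l.neg.map f, ?_⟩, fun y => RealEffect.eval_congr ?_ ?_⟩
  · intro s' hs' t' ht'
    obtain ⟨s, hs, rfl⟩ := Option.mem_map.1 hs'
    obtain ⟨t, ht, rfl⟩ := Option.mem_map.1 ht'
    obtain ⟨h1, h2, h3⟩ := l.compat s hs t ht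
    cases s with
    | bot => exact absurd rfl h1
    | yes =>
      obtain rfl : t = B.no := B.eq_of_le (by simp [Bot.bot]) h3
      exact ⟨hx, hsx, le_rfl⟩
    | no =>
      obtain rfl : t = B.yes := B.eq_of_le (by simp [Bot.bot]) h3
      exact ⟨hsx, hx, (Qubit.star_star x).le⟩
  · simp [hf]
  · simp [hf]

/-- The definition of `measure` ranges over all representatives; for real maps the image class does
not depend on the choice. -/
theorem measure_eq_clc_image {S T : Type} [PartialOrder S] [OrderBot S] [Star S]
    [PartialOrder T] [OrderBot T] [Star T] {l : RealEffect S} {m : RealEffect T}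
    (hl : IsRealMap l.eval) (hm : IsRealMap m.eval) (J : Set (Tensor S T)) :
    measure l m J = clc (Tensor.map l.eval hl m.eval hm '' J) := by
  unfold measure
  congr 1
  ext y
  constructor
  · rintro ⟨u, hu, hJ, rfl⟩
    exact ⟨_, hJ, rfl⟩
  · rintro ⟨x, hx, rfl⟩
    induction x using Tensor.ind_mk with | _ u hu => ?_
    exact ⟨u, hu, hx, rfl⟩

theorem Tensor.map_pair {S T S' T' : Type} [PartialOrder S] [OrderBot S] [Star S]
    [PartialOrder T] [OrderBot T] [Star T] [PartialOrder S'] [OrderBot S'] [Star S']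
    [PartialOrder T'] [OrderBot T'] [Star T'] {f : S → S'} (hf : IsRealMap f)
    {g : T → T'} (hg : IsRealMap g) (a a' : S) (b b' : T) :
    Tensor.map f hf g hg (Tensor.pair a b a' b') = Tensor.pair (f a) (g b) (f a') (g b') := by
  change Tensor.mk (Prod.map f g '' {(a, b), (a', b')}) _ = Tensor.mk {_, _} _
  congr 1
  simp [Set.image_pair]

/-! ### States of `𝔅 ⊗ 𝔅` -/

theorem Tensor.eq_of_value {S T : Type} [PartialOrder S] [OrderBot S] [Star S]
    [PartialOrder T] [OrderBot T] [Star T] {x y : Tensor S T}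
    (h : ∀ (l : RealEffect S) (m : RealEffect T),
      (x.value l m = B.yes ↔ y.value l m = B.yes) ∧ (x.value l m = B.no ↔ y.value l m = B.no)) :
    x = y :=
  le_antisymm (Tensor.le_iff.2 fun l m => ⟨(h l m).1.1, (h l m).2.1⟩)
    (Tensor.le_iff.2 fun l m => ⟨(h l m).1.2, (h l m).2.2⟩)

theorem B.eval_bot_eq_iff (l : RealEffect B) {c s : B} (hc : c ≠ B.bot) (hs : s ≠ B.bot) :
    l.eval ⊥ = c ↔ l.eval s = c ∧ l.eval (star s) = c := by
  constructor
  · intro h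
    exact ⟨l.eval_eq_of_eval_bot hc h _, l.eval_eq_of_eval_bot hc h _⟩
  · rintro ⟨h, h'⟩
    refine l.eval_bot_of_eval_eq B.isFlat (a := s) (a' := star s) ?_ h h'
    cases s <;> simp_all [star]

/-- In `B` a factor `⊥` can be replaced by the infimum over `s` and `s⋆`. Both sides then become `s
⊗ t⋆ ⊓ s ⊗ t ⊓ s⋆ ⊗ t`. -/
theorem pair_swap_eq {s t : B} (hs : s ≠ B.bot) (ht : t ≠ B.bot) :
    Tensor.pair s (star t) ⊥ t = Tensor.pair s ⊥ (star s) t := by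
  refine Tensor.eq_of_value fun l m => ?_
  simp only [Tensor.value_pair_eq_yes, Tensor.value_pair_eq_no,
    B.eval_bot_eq_iff l (c := B.yes) (by simp) hs, B.eval_bot_eq_iff m (c := B.yes) (by simp) ht,
    B.eval_bot_eq_iff l (c := B.no) (by simp) hs, B.eval_bot_eq_iff m (c := B.no) (by simp) ht]
  grind

theorem Tensor.pair_comm {S T : Type} [PartialOrder S] [OrderBot S] [Star S]
    [PartialOrder T] [OrderBot T] [Star T] (a a' : S) (b b' : T) :
    Tensor.pair a b a' b' = Tensor.pair a' b' a b := by
  unfold Tensor.pair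
  congr 1
  exact Set.pair_comm _ _

theorem Tensor.pair_bot_bot (a b : B) : Tensor.pair a b ⊥ ⊥ = ⊥ :=
  le_bot_iff.1 (pair_le_right a b ⊥ ⊥)

theorem Tensor.bot_bot_pair (a b : B) : Tensor.pair ⊥ ⊥ a b = ⊥ :=
  le_bot_iff.1 (pair_le_left ⊥ ⊥ a b)

theorem cross_le_pair_star {s t : B} (hs : s ≠ ⊥) (ht : t ≠ ⊥) :
    Tensor.pair s ⊥ ⊥ t ≤ Tensor.pair s ⊥ (star s) t := by
  rw [Tensor.le_pair, cross_le_tmul B.isFlat B.isFlat hs ht, cross_le_tmul B.isFlat B.isFlat hs ht]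
  exact ⟨Or.inl rfl, Or.inr rfl⟩

/-- The effect `𝔩_(N,Y)` of `𝔅`. -/
def B.starEffect : RealEffect B where
  pos := some B.no
  neg := some B.yes
  compat := by
    rintro _ ⟨⟩ _ ⟨⟩
    exact ⟨by simp [Bot.bot], by simp [Bot.bot], Or.inr rfl⟩

theorem B.eval_starEffect (x : B) : B.starEffect.eval x = star x := by
  rcases x <;> simp [RealEffect.eval, B.starEffect, LE.le, star]

theorem B.star_eq_no {x : B} : star x = B.no ↔ x = B.yes := by
  cases x <;> simp [star]

/-- No state of the fourth tensor power of `𝔅` has the four given marginals. -/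
theorem not_exists_marginals (L : B4)
    (h13 : zeta13 L = Tensor.pair B.no ⊥ B.yes B.no)
    (h14 : zeta14 L = Tensor.pair B.yes ⊥ B.no B.yes)
    (h23 : zeta23 L = Tensor.pair B.yes B.no ⊥ B.yes)
    (h24 : zeta24 L = Tensor.tmul ⊥ ⊥) : False := by
  induction L using Tensor.ind_mk with | _ u hu => ?_
  have e13 : ∀ p ∈ u, zeta1 p.1 = B.no ∨ zeta1 p.2 = B.no := by
    have h : (zeta13 (Tensor.mk u hu)).value B.idEffect B.idEffect = B.no := by
      rw [h13, Tensor.value_pair_eq_no]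
      simp [B.eval_idEffect]
    have := Tensor.value_mk_eq_no (hu := hu.image (Prod.map zeta1 zeta1)).1 h
    simpa only [Set.forall_mem_image, B.eval_idEffect, Prod.map] using this
  -- `B.starEffect` exchanges `Y` and `N`, so that a disjunction of `Y`s is seen as the absorbing
  -- value `N`.
  have e14 : ∀ p ∈ u, zeta1 p.1 = B.yes ∨ zeta2 p.2 = B.yes := by
    have h : (zeta14 (Tensor.mk u hu)).value B.starEffect B.starEffect = B.no := by
      rw [h14, Tensor.value_pair_eq_no]
      simp [B.eval_starEffect, B.star_eq_no]
    have := Tensor.value_mk_eq_no (hu := hu.image (Prod.map zeta1 zeta2)).1 h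
    simpa only [Set.forall_mem_image, B.eval_starEffect, B.star_eq_no, Prod.map] using this
  have e23 : ∀ p ∈ u, zeta2 p.1 = B.yes ∨ zeta1 p.2 = B.yes := by
    have h : (zeta23 (Tensor.mk u hu)).value B.starEffect B.starEffect = B.no := by
      rw [h23, Tensor.value_pair_eq_no]
      simp [B.eval_starEffect, B.star_eq_no]
    have := Tensor.value_mk_eq_no (hu := hu.image (Prod.map zeta2 zeta1)).1 h
    simpa only [Set.forall_mem_image, B.eval_starEffect, B.star_eq_no, Prod.map] using this
  -- In each term, `a₁ = N` forces `a₄ = Y` by `e14`, and `a₃ = N` forces `a₂ = Y` by `e23`; by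
  -- `e13` one of these occurs.
  have e24 : (zeta24 (Tensor.mk u hu)).value B.starEffect B.starEffect = B.no := by
    refine (Tensor.value_mk_eq_no (hu := hu.image (Prod.map zeta2 zeta2))).2 ?_
    simp only [Set.forall_mem_image, B.eval_starEffect, B.star_eq_no, Prod.map]
    intro p hp
    have := e13 p hp
    have := e14 p hp
    have := e23 p hp
    grind
  rw [h24, Tensor.value_tmul_eq_no] at e24
  simp [B.eval_starEffect, B.star_eq_no, Bot.bot] at e24

/-! ### Crosses and their stars in the tensor product of two spaces `Qubit` -/

section QubitPair

variable {M N : ℕ}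

theorem cross_le_pair_iff {s a a' : Qubit M} {t b b' : Qubit N} (hs : s ≠ ⊥) (ht : t ≠ ⊥) :
    Tensor.pair s ⊥ ⊥ t ≤ Tensor.pair a b a' b' ↔ (s = a ∨ t = b) ∧ (s = a' ∨ t = b') := by
  rw [Tensor.le_pair, cross_le_tmul (Qubit.isFlat M) (Qubit.isFlat N) hs ht,
    cross_le_tmul (Qubit.isFlat M) (Qubit.isFlat N) hs ht]

/-- For consistency only lower bounds of the star matter. The supremum defining it exists because
every `c ⊗ d` above the state is above the cross of `(a, b')`, so `c = a` or `d = b'`, and the cross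
of `(c⋆, d⋆)` is below `a⋆ ⊗ b'⋆`. -/
theorem star_pair_le {a a' : Qubit M} {b b' : Qubit N}
    (ha : a ≠ ⊥) (ha' : a' ≠ ⊥) (hb : b ≠ ⊥) (hb' : b' ≠ ⊥) {v : Tensor (Qubit M) (Qubit N)}
    (h : star (Tensor.pair a b a' b') ≤ v) :
    Tensor.pair (star a) ⊥ ⊥ (star b) ≤ v ∧ Tensor.pair (star a') ⊥ ⊥ (star b') ≤ v := by
  have hz : ∀ c d, IsMax c → IsMax d → Tensor.pair a b a' b' ≤ Tensor.tmul c d →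
      Tensor.pair (star c) ⊥ ⊥ (star d) ≤ Tensor.tmul (star a) (star b') := by
    intro c d hc hd hcd
    have h1 := ((cross_le_pair_iff (a := a) (b := b) (a' := a') (b' := b') ha hb').2
      ⟨Or.inl rfl, Or.inr rfl⟩).trans hcd
    have h2 := ((cross_le_pair_iff (a := a) (b := b) (a' := a') (b' := b') ha' hb).2
      ⟨Or.inr rfl, Or.inl rfl⟩).trans hcd
    rw [cross_le_tmul (Qubit.isFlat M) (Qubit.isFlat N) ha hb'] at h1
    rw [cross_le_tmul (Qubit.isFlat M) (Qubit.isFlat N) ha' hb] at h2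
    rw [cross_le_tmul (Qubit.isFlat M) (Qubit.isFlat N)
      (Qubit.star_ne_bot (Qubit.ne_bot_of_isMax ha hc))
      (Qubit.star_ne_bot (Qubit.ne_bot_of_isMax hb hd)), Qubit.star_inj, Qubit.star_inj]
    grind
  obtain ⟨h1, h2⟩ := Tensor.le_pair.1 (le_refl (Tensor.pair a b a' b'))
  exact ⟨Tensor.pair_star_le hz h (Qubit.isMax ha) (Qubit.isMax hb) h1,
    Tensor.pair_star_le hz h (Qubit.isMax ha') (Qubit.isMax hb') h2⟩

/-- The star dominates the cross of `(s⋆, t⋆)`, whereas the cross of `(s, t)` is below `s ⊗ t`; the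
inequality would force `s⋆ = s` or `t⋆ = t`. -/
theorem not_star_cross_le {s : Qubit M} {t : Qubit N} (hs : s ≠ ⊥) (ht : t ≠ ⊥) :
    ¬ star (Tensor.pair s ⊥ ⊥ t) ≤ Tensor.pair s ⊥ ⊥ t := by
  intro h
  have hz : ∀ c d, IsMax c → IsMax d → Tensor.pair s ⊥ ⊥ t ≤ Tensor.tmul c d →
      Tensor.pair (star c) ⊥ ⊥ (star d) ≤ Tensor.tmul (star s) (star t) := by
    intro c d hc hd hcd
    rw [cross_le_tmul (Qubit.isFlat M) (Qubit.isFlat N) hs ht] at hcd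
    rw [cross_le_tmul (Qubit.isFlat M) (Qubit.isFlat N)
      (Qubit.star_ne_bot (Qubit.ne_bot_of_isMax hs hc))
      (Qubit.star_ne_bot (Qubit.ne_bot_of_isMax ht hd)), Qubit.star_inj, Qubit.star_inj]
    exact hcd.imp Eq.symm Eq.symm
  have h3 := Tensor.pair_star_le hz h (Qubit.isMax hs) (Qubit.isMax ht)
    ((cross_le_tmul (Qubit.isFlat M) (Qubit.isFlat N) hs ht).2 (Or.inl rfl))
  have h4 := h3.trans ((cross_le_tmul (Qubit.isFlat M) (Qubit.isFlat N) hs ht).2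
    (Or.inl rfl) : _ ≤ Tensor.tmul s t)
  rw [cross_le_tmul (Qubit.isFlat M) (Qubit.isFlat N) (Qubit.star_ne_bot hs)
    (Qubit.star_ne_bot ht)] at h4
  rcases h4 with h4 | h4
  · exact Qubit.star_ne_self hs h4
  · exact Qubit.star_ne_self ht h4

end QubitPair

/-! ### The hidden state: closure, consistency and measurement outcomes -/

section NonlocalState

variable {M N : ℕ}

theorem triangle_qubit {a₁ a₂ : Qubit M} {b₁ b₂ : Qubit N} (ha₁ : a₁ ≠ ⊥) (ha₂ : a₂ ≠ ⊥)
    (hb₁ : b₁ ≠ ⊥) (hb₂ : b₂ ≠ ⊥) (ha : a₁ ≠ a₂) (ha' : star a₁ ≠ a₂) (hb : b₁ ≠ b₂)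
    (hb' : star b₁ ≠ b₂) :
    Triangle (Tensor.pair a₁ ⊥ ⊥ b₂) (Tensor.pair a₂ ⊥ ⊥ b₁)
      (Tensor.pair (star a₁) ⊥ ⊥ (star b₁)) (Tensor.pair a₁ b₁ a₂ b₂)
      (Tensor.pair a₁ (star b₁) (star a₁) b₂) (Tensor.pair a₂ (star b₁) (star a₁) b₁) := by
  have hsa := Qubit.star_ne_bot ha₁
  have hsb := Qubit.star_ne_bot hb₁
  have hsa' := Qubit.star_ne_self ha₁
  have hsb' := Qubit.star_ne_self hb₁
  have hS := Qubit.isFlat M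
  have hT := Qubit.isFlat N
  refine ⟨isLUB_pair hS hT ha hb ha₁ ha₂ hb₁ hb₂,
    isLUB_pair hS hT hsa'.symm hb' ha₁ hsa hsb hb₂,
    isLUB_pair hS hT ha'.symm hsb' ha₂ hsa hsb hb₁, ?_, ?_⟩
  · intro z h1 h2 h3
    -- A bound may be enlarged to a tensor `c ⊗ d`. Each of `c` and `d` matches at most one of the
    -- three crosses.
    obtain ⟨c, d, hz⟩ := z.exists_le_tmul
    have h1 := (cross_le_tmul hS hT ha₁ hb₂).1 (h1.trans hz)
    have h2 := (cross_le_tmul hS hT ha₂ hb₁).1 (h2.trans hz)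
    have h3 := (cross_le_tmul hS hT hsa hsb).1 (h3.trans hz)
    grind
  · rintro v w (h | h | h) h1 h2 h3
    · exact le_of_le_pair hS hT ha hb h h1 h2
    · exact le_of_le_pair hS hT hsa'.symm hb' h h1 h3
    · exact le_of_le_pair hS hT ha'.symm hsb' h h2 h3

theorem mem_completion_of_not_star_le {S : Type} [PartialOrder S] [OrderBot S] [Star S] {s : S}
    (hs : s ≠ ⊥) (h : ¬ star s ≤ s) : {s} ∈ Completion S := by
  have hc : clc {s} = {s} := clc_eq_singleton rfl (by simp)
  refine ⟨{s}, Or.inl ⟨by simpa using hs, ?_⟩, hc⟩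
  rw [hc]
  exact ⟨by simpa using hs, by simpa using h⟩

theorem cross_ne_bot {s : Qubit M} {t : Qubit N} (hs : s ≠ ⊥) (ht : t ≠ ⊥) :
    Tensor.pair s ⊥ ⊥ t ≠ ⊥ := by
  intro h
  have := h ▸ (bot_le : ⊥ ≤ Tensor.tmul (⊥ : Qubit M) (⊥ : Qubit N))
  rw [cross_le_tmul (Qubit.isFlat M) (Qubit.isFlat N) hs ht] at this
  exact this.elim hs ht

theorem hiddenState_mem_completion {a₁ a₂ : Qubit M} {b₁ b₂ : Qubit N} (ha₁ : a₁ ≠ ⊥)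
    (ha₂ : a₂ ≠ ⊥) (hb₁ : b₁ ≠ ⊥) (hb₂ : b₂ ≠ ⊥) (ha : a₁ ≠ a₂) (ha' : star a₁ ≠ a₂)
    (hb : b₁ ≠ b₂) (hb' : star b₁ ≠ b₂) :
    {Tensor.pair a₁ b₁ a₂ b₂} ∈ Completion (Tensor (Qubit M) (Qubit N)) ∧
    {Tensor.pair (star a₁) ⊥ ⊥ (star b₁)} ∈ Completion (Tensor (Qubit M) (Qubit N)) ∧
    {Tensor.pair a₁ b₁ a₂ b₂, Tensor.pair a₁ (star b₁) (star a₁) b₂,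
      Tensor.pair a₂ (star b₁) (star a₁) b₁} ∈ Completion (Tensor (Qubit M) (Qubit N)) := by
  have H := triangle_qubit ha₁ ha₂ hb₁ hb₂ ha ha' hb hb'
  have hle := H.le
  have hsa := Qubit.star_ne_bot ha₁
  have hsb := Qubit.star_ne_bot hb₁
  have hsa' := Qubit.star_ne_self ha₁
  have hsb' := Qubit.star_ne_self hb₁
  have hsa₂ := Qubit.star_ne_bot ha₂
  have hsb₂ := Qubit.star_ne_bot hb₂
  have hsa₂' := Qubit.star_ne_self ha₂
  have hsb₂' := Qubit.star_ne_self hb₂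
  have hssa := Qubit.star_star a₁
  have hssb := Qubit.star_star b₁
  have hssa₂ := Qubit.star_star a₂
  have hssb₂ := Qubit.star_star b₂
  have hA := cross_ne_bot ha₁ hb₂
  have hB := cross_ne_bot ha₂ hb₁
  have hC := cross_ne_bot hsa hsb
  have nx : Tensor.pair a₁ b₁ a₂ b₂ ≠ ⊥ := fun e => hA (le_bot_iff.1 (e ▸ hle.1))
  have np : Tensor.pair a₁ (star b₁) (star a₁) b₂ ≠ ⊥ :=
    fun e => hA (le_bot_iff.1 (e ▸ hle.2.2.1))
  have nq : Tensor.pair a₂ (star b₁) (star a₁) b₁ ≠ ⊥ :=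
    fun e => hB (le_bot_iff.1 (e ▸ hle.2.2.2.2.1))
  -- Each star dominates the crosses of the starred entries of its two tensors; no member of the
  -- triple has both of these below it.
  have cons : ∀ s ∈ ({Tensor.pair a₁ b₁ a₂ b₂, Tensor.pair a₁ (star b₁) (star a₁) b₂,
      Tensor.pair a₂ (star b₁) (star a₁) b₁} : Set _),
      ∀ t ∈ ({Tensor.pair a₁ b₁ a₂ b₂, Tensor.pair a₁ (star b₁) (star a₁) b₂,
      Tensor.pair a₂ (star b₁) (star a₁) b₁} : Set _), ¬ star s ≤ t := by
    rintro _ (rfl | rfl | rfl) t ht h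
    · obtain ⟨h1, h2⟩ := star_pair_le ha₁ ha₂ hb₁ hb₂ h
      rcases ht with rfl | rfl | rfl <;>
        rw [cross_le_pair_iff (by assumption) (by assumption)] at h1 h2 <;> grind
    · obtain ⟨h1, h2⟩ := star_pair_le ha₁ hsa hsb hb₂ h
      rw [hssb] at h1
      rw [hssa] at h2
      rcases ht with rfl | rfl | rfl <;>
        rw [cross_le_pair_iff (by assumption) (by assumption)] at h1 h2 <;> grind
    · obtain ⟨h1, h2⟩ := star_pair_le ha₂ hsa hsb hb₁ h
      rw [hssb] at h1
      rw [hssa] at h2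
      rcases ht with rfl | rfl | rfl <;>
        rw [cross_le_pair_iff (by assumption) (by assumption)] at h1 h2 <;> grind
  refine ⟨mem_completion_of_not_star_le nx (cons _ (by simp) _ (by simp)),
    mem_completion_of_not_star_le hC (not_star_cross_le hsa hsb),
    _, Or.inl ⟨?_, ?_⟩, H.clc_eq⟩
  · rintro _ (rfl | rfl)
    exacts [nx, hC]
  · rw [H.clc_eq]
    refine ⟨?_, cons⟩
    rintro _ (rfl | rfl | rfl)
    exacts [nx, np, nq]

theorem measure_triple {a₁ a₂ a₃ a₁' a₂' a₃' s : Qubit M} {b₁ b₂ b₃ b₁' b₂' b₃' t : Qubit N}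
    (hs : s ≠ ⊥) (ht : t ≠ ⊥) :
    measure (s.effect hs) (t.effect ht)
      {Tensor.pair a₁ b₁ a₁' b₁', Tensor.pair a₂ b₂ a₂' b₂', Tensor.pair a₃ b₃ a₃' b₃'} =
    clc {Tensor.pair ((s.effect hs).eval a₁) ((t.effect ht).eval b₁) ((s.effect hs).eval a₁')
        ((t.effect ht).eval b₁'),
      Tensor.pair ((s.effect hs).eval a₂) ((t.effect ht).eval b₂) ((s.effect hs).eval a₂')
        ((t.effect ht).eval b₂'),
      Tensor.pair ((s.effect hs).eval a₃) ((t.effect ht).eval b₃) ((s.effect hs).eval a₃')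
        ((t.effect ht).eval b₃')} := by
  rw [measure_eq_clc_image (isRealMap_effect hs) (isRealMap_effect ht)]
  simp only [Set.image_insert_eq, Set.image_singleton, Tensor.map_pair]

theorem measure_hiddenState {a₁ a₂ : Qubit M} {b₁ b₂ : Qubit N} (ha₁ : a₁ ≠ ⊥)
    (ha₂ : a₂ ≠ ⊥) (hb₁ : b₁ ≠ ⊥) (hb₂ : b₂ ≠ ⊥) (ha : a₁ ≠ a₂) (ha' : star a₁ ≠ a₂)
    (hb : b₁ ≠ b₂) (hb' : star b₁ ≠ b₂) {J : Set (Tensor (Qubit M) (Qubit N))}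
    (hJ : J = {Tensor.pair a₁ b₁ a₂ b₂, Tensor.pair a₁ (star b₁) (star a₁) b₂,
      Tensor.pair a₂ (star b₁) (star a₁) b₁}) :
    measure (a₁.effect ha₁) (b₁.effect hb₁) J = {Tensor.pair B.no ⊥ B.yes B.no} ∧
    measure (a₁.effect ha₁) (b₂.effect hb₂) J = {Tensor.pair B.yes ⊥ B.no B.yes} ∧
    measure (a₂.effect ha₂) (b₁.effect hb₁) J = {Tensor.pair B.yes B.no ⊥ B.yes} ∧
    measure (a₂.effect ha₂) (b₂.effect hb₂) J = {Tensor.tmul ⊥ ⊥} := by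
  have hsa : star a₂ ≠ a₁ := fun h => ha' (by rw [← h, Qubit.star_star])
  have hsb : star b₂ ≠ b₁ := fun h => hb' (by rw [← h, Qubit.star_star])
  have e₁ := a₁.eval_effect_of_ne ha₁ ha ha'
  have e₂ := a₂.eval_effect_of_ne ha₂ ha.symm hsa
  have e₃ := a₂.eval_effect_of_ne ha₂ ha'.symm (fun h => ha (Qubit.star_inj.1 h).symm)
  have f₁ := b₁.eval_effect_of_ne hb₁ hb hb'
  have f₂ := b₂.eval_effect_of_ne hb₂ hb.symm hsb
  have f₃ := b₂.eval_effect_of_ne hb₂ hb'.symm (fun h => hb (Qubit.star_inj.1 h).symm)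
  have bot_eq : B.bot = ⊥ := rfl
  have yn : B.yes ≠ ⊥ := by simp [Bot.bot]
  have nn : B.no ≠ ⊥ := by simp [Bot.bot]
  have key : ∀ {U : Set (Tensor B B)} {g : Tensor B B}, g ∈ U → (∀ u ∈ U, u ≤ g) → clc U = {g} :=
    clc_eq_singleton
  subst hJ
  simp only [measure_triple, Qubit.eval_effect_self, Qubit.eval_effect_star, e₁, e₂, e₃, f₁, f₂,
    f₃, bot_eq, Tensor.pair_bot_bot, Tensor.bot_bot_pair]
  -- The greatest image comes from `p`, `p`, `q` in the first three cases, and in the last case all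
  -- images are `⊥`.
  refine ⟨key ?_ ?_, key ?_ ?_, key ?_ ?_, key ?_ ?_⟩
  · exact Or.inr (Or.inl (Tensor.pair_comm _ _ _ _))
  · rintro _ (rfl | rfl | rfl)
    · exact bot_le
    · exact (Tensor.pair_comm _ _ _ _).le
    · rw [Tensor.pair_comm]
      exact (pair_swap_eq nn nn).le
  · exact Or.inr (Or.inl rfl)
  · rintro _ (rfl | rfl | rfl)
    · exact cross_le_pair_star yn yn
    · exact le_rfl
    · exact bot_le
  · exact Or.inr (Or.inr rfl)
  · rintro _ (rfl | rfl | rfl)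
    · rw [Tensor.pair_comm]
      exact (cross_le_pair_star yn yn).trans (pair_swap_eq yn yn).ge
    · exact bot_le
    · exact le_rfl
  · exact Or.inr (Or.inl rfl)
  · rintro _ (rfl | rfl | rfl) <;> exact le_rfl

/-- The supremum of `a₁ ⊗ b₁ ⊓ a₂ ⊗ b₂` and `a₁⋆ ⊗ ⊥ ⊓ ⊥ ⊗ b₁⋆` is a Bell non-local hidden
state. -/
theorem exists_nonlocal_join {a₁ a₂ : Qubit M} {b₁ b₂ : Qubit N} (ha₁ : a₁ ≠ ⊥)
    (ha₂ : a₂ ≠ ⊥) (hb₁ : b₁ ≠ ⊥) (hb₂ : b₂ ≠ ⊥) (ha : a₁ ≠ a₂) (ha' : a₁ ≠ star a₂)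
    (hb : b₁ ≠ b₂) (hb' : b₁ ≠ star b₂) :
    {Tensor.pair a₁ b₁ a₂ b₂} ∈ Completion (Tensor (Qubit M) (Qubit N)) ∧
    {Tensor.pair (star a₁) ⊥ ⊥ (star b₁)} ∈ Completion (Tensor (Qubit M) (Qubit N)) ∧
    ∃ J : Set (Tensor (Qubit M) (Qubit N)),
      IsJoin {Tensor.pair a₁ b₁ a₂ b₂} {Tensor.pair (star a₁) ⊥ ⊥ (star b₁)} J ∧
      IsHidden J ∧
      measure (a₁.effect ha₁) (b₁.effect hb₁) J = {Tensor.pair B.no ⊥ B.yes B.no} ∧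
      measure (a₁.effect ha₁) (b₂.effect hb₂) J = {Tensor.pair B.yes ⊥ B.no B.yes} ∧
      measure (a₂.effect ha₂) (b₁.effect hb₁) J = {Tensor.pair B.yes B.no ⊥ B.yes} ∧
      measure (a₂.effect ha₂) (b₂.effect hb₂) J = {Tensor.tmul ⊥ ⊥} ∧
      ¬ Reproducible (a₁.effect ha₁) (a₂.effect ha₂) (b₁.effect hb₁) (b₂.effect hb₂) J ∧
      BellNonlocal J := by
  have ha'' : star a₁ ≠ a₂ := fun h => ha' (by rw [← h, Qubit.star_star])
  have hb'' : star b₁ ≠ b₂ := fun h => hb' (by rw [← h, Qubit.star_star])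
  have H := triangle_qubit ha₁ ha₂ hb₁ hb₂ ha ha'' hb hb''
  obtain ⟨hx, hc, hJ⟩ := hiddenState_mem_completion ha₁ ha₂ hb₁ hb₂ ha ha'' hb hb''
  obtain ⟨m13, m14, m23, m24⟩ := measure_hiddenState ha₁ ha₂ hb₁ hb₂ ha ha'' hb hb'' rfl
  have hR : ¬ Reproducible (a₁.effect ha₁) (a₂.effect ha₂) (b₁.effect hb₁) (b₂.effect hb₂)
      {Tensor.pair a₁ b₁ a₂ b₂, Tensor.pair a₁ (star b₁) (star a₁) b₂,
        Tensor.pair a₂ (star b₁) (star a₁) b₁} := by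
    rintro ⟨L, h13, h14, h23, h24⟩
    rw [m13] at h13
    rw [m14] at h14
    rw [m23] at h23
    rw [m24] at h24
    exact not_exists_marginals L (Set.singleton_injective h13) (Set.singleton_injective h14)
      (Set.singleton_injective h23) (Set.singleton_injective h24)
  exact ⟨hx, hc, _, H.isJoin hJ, H.isHidden hJ, m13, m14, m23, m24, hR, _, _, _, _, hR⟩

end NonlocalState

end Ontic

theorem mainTheorem1 (NA NB : ℕ) (hA : 2 ≤ NA) (hB : 2 ≤ NB) :
    (∃ J : Set (Ontic.Tensor (Ontic.Qubit NA) (Ontic.Qubit NB)),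
      Ontic.IsHidden J ∧ Ontic.BellNonlocal J) ∧
    ∀ (σ₁ σ₂ : Ontic.Qubit NA) (τ₁ τ₂ : Ontic.Qubit NB)
      (hσ₁ : σ₁ ≠ ⊥) (hσ₂ : σ₂ ≠ ⊥) (hτ₁ : τ₁ ≠ ⊥) (hτ₂ : τ₂ ≠ ⊥),
      σ₁ ≠ σ₂ → σ₁ ≠ star σ₂ → τ₁ ≠ τ₂ → τ₁ ≠ star τ₂ →
      {Ontic.Tensor.pair σ₁ τ₁ σ₂ τ₂} ∈
        Ontic.Completion (Ontic.Tensor (Ontic.Qubit NA) (Ontic.Qubit NB)) ∧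
      {Ontic.Tensor.pair (star σ₁) ⊥ ⊥ (star τ₁)} ∈
        Ontic.Completion (Ontic.Tensor (Ontic.Qubit NA) (Ontic.Qubit NB)) ∧
      ∃ J : Set (Ontic.Tensor (Ontic.Qubit NA) (Ontic.Qubit NB)),
        Ontic.IsJoin {Ontic.Tensor.pair σ₁ τ₁ σ₂ τ₂}
          {Ontic.Tensor.pair (star σ₁) ⊥ ⊥ (star τ₁)} J ∧
        Ontic.IsHidden J ∧
        Ontic.measure (σ₁.effect hσ₁) (τ₁.effect hτ₁) J =
          {Ontic.Tensor.pair Ontic.B.no ⊥ Ontic.B.yes Ontic.B.no} ∧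
        Ontic.measure (σ₁.effect hσ₁) (τ₂.effect hτ₂) J =
          {Ontic.Tensor.pair Ontic.B.yes ⊥ Ontic.B.no Ontic.B.yes} ∧
        Ontic.measure (σ₂.effect hσ₂) (τ₁.effect hτ₁) J =
          {Ontic.Tensor.pair Ontic.B.yes Ontic.B.no ⊥ Ontic.B.yes} ∧
        Ontic.measure (σ₂.effect hσ₂) (τ₂.effect hτ₂) J =
          {Ontic.Tensor.tmul ⊥ ⊥} ∧
        ¬ Ontic.Reproducible (σ₁.effect hσ₁) (σ₂.effect hσ₂)
          (τ₁.effect hτ₁) (τ₂.effect hτ₂) J ∧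
        Ontic.BellNonlocal J := by
  refine ⟨?_, fun σ₁ σ₂ τ₁ τ₂ hσ₁ hσ₂ hτ₁ hτ₂ h1 h2 h3 h4 =>
    Ontic.exists_nonlocal_join hσ₁ hσ₂ hτ₁ hτ₂ h1 h2 h3 h4⟩
  obtain ⟨σ₁, σ₂, hσ₁, hσ₂, h1, h2⟩ := Ontic.Qubit.exists_pure_ne hA
  obtain ⟨τ₁, τ₂, hτ₁, hτ₂, h3, h4⟩ := Ontic.Qubit.exists_pure_ne hB
  obtain ⟨-, -, J, -, hJ, -, -, -, -, -, hn⟩ :=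
    Ontic.exists_nonlocal_join hσ₁ hσ₂ hτ₁ hτ₂ h1 h2 h3 h4
  exact ⟨J, hJ, hn⟩
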